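/- **Setting.** A dimension function is a map $\Phi:(0,1)\to\mathbb R$ such that $\Phi\ge 0$ near $0$ and $t^{1+\Phi(t)}$ decreases to $0$ as $t$ decreases to $0$. It is *large* if $\Phi(t)=H(t)\,\frac{\log|\log t|}{|\log t|}$ near $0$ with $H(t)\to\infty$ as $t\to0^+$. For a finite Borel measure $\mu$ on a metric space, the upper $\Phi$-dimension $\overline{\dim}_\Phi\mu$ is the infimum in $[-\infty,\infty]$ of all $d\in\mathbb R$ for which there are $C_1\in(0,1)$ and $C_2>0$ such that $$\frac{\mu(B(x,R))}{\mu(B(x,r))}\le C_2\Big(\frac Rr\Big)^d\quad\text{for all }x\in\operatorname{supp}\mu\text{ and all }0<r<R^{1+\Phi(R)}\le R\le C_1 ,$$ and the lower $\Phi$-dimension $\underline{\dim}_\Phi\mu$ is the supremum in $[-\infty,\infty]$ of all $d\in\mathbb R$ for which the same holds with $\ge$ in place of $\le$ in the displayed inequality between the ratio of measures and $C_2(R/r)^d$. Let $(\Omega,\mathcal P)$ be a probability space and $0<A<B<1$. Let $(a_n,b_n)_{n\ge1}$ be i.i.d. random pairs with $A\le\min(a_n,b_n)$ and $a_n+b_n\le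 B$, and let $(p_n)_{n\ge1}$ be i.i.d. random variables in $[0,1]$, the sequence $(p_n)_n$ being independent of the sequence $(a_n,b_n)_n$, such that for some $t>0$ both $\mathbb E(p_1^{-t})<\infty$ and $\mathbb E((1-p_1)^{-t})<\infty$ (with $0^{-t}=\infty$). For $\omega\in\Omega$ start with the interval $[0,1]$ of level $0$. Each interval $I$ of level $n-1$ has two children of level $n$: the closed subinterval of length $a_n(\omega)|I|$ with the same left endpoint as $I$ and the closed subinterval of length $b_n(\omega)|I|$ with the same right endpoint as $I$. The random Moran measure $\mu_\omega$ is the Borel probability measure on $\mathbb R$ with $\mu_\omega([0,1])=1$ which gives the left child of each interval $I$ of level $n-1$ the mass $p_n(\omega)\mu_\omega(I)$ and the right child the mass $(1-p_n(\omega))\mu_\omega(I)$. For $\theta\ge0$ let $$(Y_n(\theta),Z_n(\theta))=\begin{cases}(\log p_n,\ \log a_n)&\text{if }p_n\le\frac{a_n^\theta}{a_n^\theta+b_n^\theta},\\(\log(1-p_n),\ \log b_n)&\text{if }p_n>\frac{a_n^\theta}{a_n^\theta+b_n^\theta},\end{cases}$$ let $(Y_n'(\theta),Z_n'(\theta))$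 be defined in the same way with the conditions $\le$ and $>$ interchanged, and put $$G(\theta)=\frac{\mathbb E\,Y_1(\theta)}{\mathbb E\,Z_1(\theta)},\qquad G'(\theta)=\frac{\mathbb E\,Y_1'(\theta)}{\mathbb E\,Z_1'(\theta)} .$$ **Theorem.** Let $\psi\ge0$. (i) If $G(\psi)<\psi$, there is a set $\Gamma_\psi\subseteq\Omega$ of full measure such that $\overline{\dim}_\Phi\mu_\omega\le\psi$ for all large dimension functions $\Phi$ and all $\omega\in\Gamma_\psi$. (ii) If $G(\psi)\ge\psi$, there is a set $\Gamma_\psi\subseteq\Omega$ of full measure such that $\overline{\dim}_\Phi\mu_\omega\ge\psi$ for all large dimension functions $\Phi$ and all $\omega\in\Gamma_\psi$. (iii) If $G'(\psi)>\psi$, there is a set $\Gamma_\psi\subseteq\Omega$ of full measure such that $\underline{\dim}_\Phi\mu_\omega\ge\psi$ for all large dimension functions $\Phi$ and all $\omega\in\Gamma_\psi$. (iv) If $G'(\psi)\le\psi$, there is a set $\Gamma_\psi\subseteq\Omega$ of full measure such that $\underline{\dim}_\Phi\mu_\omega\le\psi$ for all large dimension functions $\Phi$ and all $\omega\in\Gamma_\psi$.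 -/

import Mathlib

open MeasureTheory ProbabilityTheory Set Filter Topology
open scoped unitInterval ENNReal

noncomputable section

/-! ### Dimension functions and the dimensions of a measure -/

/-- A dimension function: `Φ ≥ 0` and `t ^ (1 + Φ t)` decreases to `0` as `t` decreases to `0`.
Only the germ of `Φ` at `0⁺` is relevant for the dimensions below, so sign and monotonicity are
asked near `0` (this includes every map `Φ : (0,1) → [0,∞)` with the property on all of `(0,1)`,
and also `log |log t| / |log t|`, which is negative for `t` close to `1`). -/
structure IsDimensionFunction (Φ : ℝ → ℝ) : Prop where
  exists_nonneg_monotone : ∃ t₀ : ℝ, 0 < t₀ ∧ (∀ t ∈ Ioo 0 t₀, 0 ≤ Φ t) ∧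
    MonotoneOn (fun t => t ^ (1 + Φ t)) (Ioo 0 t₀)
  tendsto_zero : Tendsto (fun t => t ^ (1 + Φ t)) (𝓝[>] 0) (𝓝 0)

/-- A large dimension function: `Φ t = H t * log |log t| / |log t|` near `0`, with `H t → ∞` as
`t → 0⁺`. -/
structure IsLargeDimensionFunction (Φ : ℝ → ℝ) : Prop extends IsDimensionFunction Φ where
  large : ∃ H : ℝ → ℝ, Tendsto H (𝓝[>] 0) atTop ∧
    ∀ᶠ t in 𝓝[>] (0 : ℝ), Φ t = H t * (Real.log |Real.log t| / |Real.log t|)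

/-- The upper `Φ`-dimension of a measure (for `R ≤ C₁ < 1`, so that `R` lies in `(0,1)`); the
infimum is taken in the extended reals, so it is `⊤` if there is no admissible exponent. -/
def upperPhiDim {X : Type*} [PseudoMetricSpace X] [MeasurableSpace X]
    (Φ : ℝ → ℝ) (μ : Measure X) : EReal :=
  sInf ((fun d : ℝ => (d : EReal)) '' {d : ℝ | ∃ C₁ C₂ : ℝ, 0 < C₁ ∧ C₁ < 1 ∧ 0 < C₂ ∧
    ∀ R r : ℝ, 0 < r → r < R ^ (1 + Φ R) → 0 < R → R ^ (1 + Φ R) ≤ R → R ≤ C₁ →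
      ∀ x ∈ μ.support,
        μ.real (Metric.ball x R) / μ.real (Metric.ball x r) ≤ C₂ * (R / r) ^ d})

/-- The lower `Φ`-dimension of a measure, as a supremum in the extended reals. -/
def lowerPhiDim {X : Type*} [PseudoMetricSpace X] [MeasurableSpace X]
    (Φ : ℝ → ℝ) (μ : Measure X) : EReal :=
  sSup ((fun d : ℝ => (d : EReal)) '' {d : ℝ | ∃ C₁ C₂ : ℝ, 0 < C₁ ∧ C₁ < 1 ∧ 0 < C₂ ∧
    ∀ R r : ℝ, 0 < r → r < R ^ (1 + Φ R) → 0 < R → R ^ (1 + Φ R) ≤ R → R ≤ C₁ →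
      ∀ x ∈ μ.support,
        C₂ * (R / r) ^ d ≤ μ.real (Metric.ball x R) / μ.real (Metric.ball x r)})

/-! ### Moran sets and Moran measures

Sequences are indexed from `0`: `a n`, `b n`, `p n` are the left ratio, the right ratio and the
left probability used in passing from level `n` to level `n + 1`. An address is a sequence
`v : ℕ → Bool`, where `false` means "left child" and `true` means "right child"; the level `N`
Moran interval of `v` depends on `v 0, …, v (N - 1)` only. -/

/-- Length of the level `N` Moran interval with address `v`. -/
def moranLength (a b : ℕ → ℝ) (v : ℕ → Bool) : ℕ → ℝ
  | 0 => 1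
  | N + 1 => moranLength a b v N * (if v N then b N else a N)

/-- Left endpoint of the level `N` Moran interval with address `v`. The right child of an
interval `[l, l + s]` is the subinterval of length `s * b` with the same right endpoint. -/
def moranLeft (a b : ℕ → ℝ) (v : ℕ → Bool) : ℕ → ℝ
  | 0 => 0
  | N + 1 => moranLeft a b v N + (if v N then moranLength a b v N * (1 - b N) else 0)

/-- The level `N` Moran interval with address `v`. -/
def moranInterval (a b : ℕ → ℝ) (v : ℕ → Bool) (N : ℕ) : Set ℝ :=
  Icc (moranLeft a b v N) (moranLeft a b v N + moranLength a b v N)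

/-- The Moran set: the intersection over all levels of the union of the Moran intervals. -/
def moranSet (a b : ℕ → ℝ) : Set ℝ :=
  ⋂ N, ⋃ v : ℕ → Bool, moranInterval a b v N

/-- The point of the Moran set with address `v`. -/
def moranPoint (a b : ℕ → ℝ) (v : ℕ → Bool) : ℝ :=
  ⨆ N, moranLeft a b v N

/-- The Moran measure: the law of the point whose address has independent digits, the digit
number `n` being "left" with probability `p n`. By `moranMeasure_moranInterval` below, it is the
probability measure that gives the left and the right child of an interval `I` of level `N` the
masses `p N * μ I` and `(1 - p N) * μ I`. -/
def moranMeasure (a b : ℕ → ℝ) (p : ℕ → I) : Measure ℝ :=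
  (Measure.infinitePi fun n => bernoulliMeasure false true (p n)).map (moranPoint a b)

theorem measurable_moranLength (a b : ℕ → ℝ) (N : ℕ) :
    Measurable fun v : ℕ → Bool => moranLength a b v N := by
  induction N with
  | zero => exact measurable_const
  | succ N ih =>
    exact ih.mul ((measurable_of_countable fun c : Bool => if c then b N else a N).comp
      (measurable_pi_apply N))

theorem measurable_moranLeft (a b : ℕ → ℝ) (N : ℕ) :
    Measurable fun v : ℕ → Bool => moranLeft a b v N := by
  induction N with
  | zero => exact measurable_const
  | succ N ih =>
    have h1 := (measurable_moranLength a b N).mul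
      ((measurable_of_countable fun c : Bool => if c then 1 - b N else 0).comp
        (measurable_pi_apply N))
    convert ih.add h1 using 1
    funext v
    simp [moranLeft]

theorem measurable_moranPoint (a b : ℕ → ℝ) : Measurable (moranPoint a b) :=
  Measurable.iSup fun N => measurable_moranLeft a b N

instance isProbabilityMeasure_moranMeasure (a b : ℕ → ℝ) (p : ℕ → I) :
    IsProbabilityMeasure (moranMeasure a b p) :=
  Measure.isProbabilityMeasure_map (measurable_moranPoint a b).aemeasurable

theorem moranLength_pos {a b : ℕ → ℝ} (ha : ∀ n, 0 < a n) (hb : ∀ n, 0 < b n)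
    (v : ℕ → Bool) (N : ℕ) : 0 < moranLength a b v N := by
  induction N with
  | zero => exact one_pos
  | succ N ih =>
    simp only [moranLength]
    split_ifs
    · exact mul_pos ih (hb N)
    · exact mul_pos ih (ha N)

theorem moranInterval_succ_subset {a b : ℕ → ℝ} (ha : ∀ n, 0 < a n) (hb : ∀ n, 0 < b n)
    (hab : ∀ n, a n + b n < 1) (v : ℕ → Bool) (N : ℕ) :
    moranInterval a b v (N + 1) ⊆ moranInterval a b v N := by
  have hl := moranLength_pos ha hb v N
  have h1 := ha N
  have h2 := hb N
  have h3 := hab N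
  apply Icc_subset_Icc <;> simp only [moranLength, moranLeft] <;> split_ifs <;> nlinarith

theorem moranPoint_mem {a b : ℕ → ℝ} (ha : ∀ n, 0 < a n) (hb : ∀ n, 0 < b n)
    (hab : ∀ n, a n + b n < 1) (v : ℕ → Bool) (N : ℕ) :
    moranPoint a b v ∈ moranInterval a b v N := by
  have hanti : Antitone (moranInterval a b v) :=
    antitone_nat_of_succ_le fun n => moranInterval_succ_subset ha hb hab v n
  have hleft : ∀ n, moranLeft a b v n ∈ moranInterval a b v n := fun n =>
    ⟨le_rfl, by linarith [moranLength_pos ha hb v n]⟩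
  have hright : ∀ n, moranLeft a b v n + moranLength a b v n ∈ moranInterval a b v n := fun n =>
    ⟨by linarith [moranLength_pos ha hb v n], le_rfl⟩
  have hle : ∀ m n, moranLeft a b v m ≤ moranLeft a b v n + moranLength a b v n := by
    intro m n
    rcases le_total m n with h | h
    · exact (hanti h (hright n)).1
    · exact (hanti h (hleft m)).2
  exact ⟨le_ciSup ⟨_, by rintro _ ⟨m, rfl⟩; exact hle m N⟩ N, ciSup_le fun m => hle m N⟩

theorem moran_congr (a b : ℕ → ℝ) {v w : ℕ → Bool} {N : ℕ} (h : ∀ i < N, v i = w i) :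
    moranLeft a b v N = moranLeft a b w N ∧ moranLength a b v N = moranLength a b w N := by
  induction N with
  | zero => exact ⟨rfl, rfl⟩
  | succ N ih =>
    obtain ⟨h1, h2⟩ := ih fun i hi => h i (by omega)
    simp only [moranLeft, moranLength, h1, h2, h N (by omega), and_self]

theorem moranPoint_mem_iff {a b : ℕ → ℝ} (ha : ∀ n, 0 < a n) (hb : ∀ n, 0 < b n)
    (hab : ∀ n, a n + b n < 1) (v w : ℕ → Bool) (N : ℕ) :
    moranPoint a b w ∈ moranInterval a b v N ↔ ∀ i < N, w i = v i := by
  constructor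
  · induction N with
    | zero => intro _ i hi; omega
    | succ N ih =>
      intro h
      have hp := ih (moranInterval_succ_subset ha hb hab v N h)
      have hw := moranPoint_mem ha hb hab w (N + 1)
      obtain ⟨h1, h2⟩ := moran_congr a b hp
      have hN : w N = v N := by
        have hl := moranLength_pos ha hb v N
        have h3 := hab N
        simp only [moranInterval, moranLeft, moranLength, mem_Icc, h1, h2] at h hw
        cases hwN : w N <;> cases hvN : v N <;> simp [hwN, hvN] at h hw ⊢ <;> nlinarith
      intro i hi
      rcases Nat.lt_succ_iff_lt_or_eq.mp hi with hi | rfl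
      · exact hp i hi
      · exact hN
  · intro h
    obtain ⟨h1, h2⟩ := moran_congr a b h
    have := moranPoint_mem ha hb hab w N
    rwa [moranInterval, h1, h2] at this

/-- The masses that define the Moran measure. -/
theorem moranMeasure_moranInterval {a b : ℕ → ℝ} (ha : ∀ n, 0 < a n) (hb : ∀ n, 0 < b n)
    (hab : ∀ n, a n + b n < 1) (p : ℕ → I) (v : ℕ → Bool) (N : ℕ) :
    moranMeasure a b p (moranInterval a b v N) =
      ∏ i ∈ Finset.range N,
        ENNReal.ofReal (if v i then 1 - (p i : ℝ) else (p i : ℝ)) := by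
  rw [moranMeasure, Measure.map_apply (measurable_moranPoint a b)
    (by exact measurableSet_Icc : MeasurableSet (moranInterval a b v N))]
  have : moranPoint a b ⁻¹' moranInterval a b v N =
      Set.pi (Finset.range N : Set ℕ) fun i => {v i} := by
    ext w
    simp [moranPoint_mem_iff ha hb hab]
  rw [this, Measure.infinitePi_pi _ (fun _ _ => measurableSet_singleton _)]
  refine Finset.prod_congr rfl fun i _ => ?_
  rw [bernoulliMeasure_apply _ (measurableSet_singleton _)]
  cases v i <;> simp [ENNReal.ofReal, Real.toNNReal, unitInterval.toNNReal, p i |>.2.1, p i |>.2.2] <;> rfl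

/-- The Moran measure is carried by the Moran set. -/
theorem moranMeasure_moranSet {a b : ℕ → ℝ} (ha : ∀ n, 0 < a n) (hb : ∀ n, 0 < b n)
    (hab : ∀ n, a n + b n < 1) (p : ℕ → I) : ∀ᵐ x ∂moranMeasure a b p, x ∈ moranSet a b := by
  have h : ∀ᵐ x ∂moranMeasure a b p, ∀ N, x ∈ ⋃ v : ℕ → Bool, moranInterval a b v N := by
    rw [ae_all_iff]
    intro N
    have hfin : (Set.range fun v : ℕ → Bool => moranInterval a b v N).Finite := by
      refine (Set.finite_range fun u : Fin N → Bool =>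
        moranInterval a b (fun i => if h : i < N then u ⟨i, h⟩ else false) N).subset ?_
      rintro _ ⟨v, rfl⟩
      refine ⟨fun i => v i, ?_⟩
      obtain ⟨h1, h2⟩ := moran_congr a b
        (v := fun i => if h : i < N then (fun i : Fin N => v i) ⟨i, h⟩ else false) (w := v)
        (N := N) fun i hi => by simp [hi]
      simp only [moranInterval, h1, h2]
    have hm : MeasurableSet (⋃ v : ℕ → Bool, moranInterval a b v N) := by
      rw [← sUnion_range]
      exact hfin.measurableSet_sUnion (by rintro _ ⟨v, rfl⟩; exact measurableSet_Icc)
    refine (ae_map_iff (measurable_moranPoint a b).aemeasurable hm).2 ?_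
    exact Eventually.of_forall fun v => mem_iUnion.2 ⟨v, moranPoint_mem ha hb hab v N⟩
  filter_upwards [h] with x hx using mem_iInter.2 hx

/-! ### The random model -/

/-- The standing assumptions on the random ratios `a n`, `b n` and the random probabilities
`p n ∈ [0,1]`. The moment condition is stated with values in `[0,∞]`, where `0 ^ (-t) = ∞`. The
moments of `a n` and `b n` need no condition, as these are bounded below by `A`. -/
structure IsRandomMoranModel {Ω : Type*} [MeasurableSpace Ω] (P : Measure Ω) (A B : ℝ)
    (a b : ℕ → Ω → ℝ) (p : ℕ → Ω → I) : Prop where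
  A_pos : 0 < A
  A_lt_B : A < B
  B_lt_one : B < 1
  measurable_a : ∀ n, Measurable (a n)
  measurable_b : ∀ n, Measurable (b n)
  measurable_p : ∀ n, Measurable (p n)
  le_min : ∀ n ω, A ≤ min (a n ω) (b n ω)
  add_le : ∀ n ω, a n ω + b n ω ≤ B
  iIndep_ratios : iIndepFun (fun n ω => (a n ω, b n ω)) P
  identDistrib_ratios : ∀ n,
    IdentDistrib (fun ω => (a n ω, b n ω)) (fun ω => (a 0 ω, b 0 ω)) P P
  iIndep_p : iIndepFun p P
  identDistrib_p : ∀ n, IdentDistrib (p n) (p 0) P P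
  indep_ratios_p : IndepFun (fun ω n => (a n ω, b n ω)) (fun ω n => p n ω) P
  moment_p : ∃ t : ℝ, 0 < t ∧
    ∫⁻ ω, ENNReal.ofReal (p 0 ω : ℝ) ^ (-t) ∂P < ∞ ∧
    ∫⁻ ω, ENNReal.ofReal (1 - (p 0 ω : ℝ)) ^ (-t) ∂P < ∞

/-- The random Moran measure `μ_ω`. -/
def randomMoranMeasure {Ω : Type*} (a b : ℕ → Ω → ℝ) (p : ℕ → Ω → I) (ω : Ω) : Measure ℝ :=
  moranMeasure (fun n => a n ω) (fun n => b n ω) (fun n => p n ω)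

/-- `Y(θ)` as a function of the left ratio, the right ratio and the left probability. -/
def branchY (θ a b p : ℝ) : ℝ :=
  if p ≤ a ^ θ / (a ^ θ + b ^ θ) then Real.log p else Real.log (1 - p)

/-- `Z(θ)`. -/
def branchZ (θ a b p : ℝ) : ℝ :=
  if p ≤ a ^ θ / (a ^ θ + b ^ θ) then Real.log a else Real.log b

/-- `Y'(θ)`: as `Y(θ)`, with the two cases interchanged. -/
def branchY' (θ a b p : ℝ) : ℝ :=
  if a ^ θ / (a ^ θ + b ^ θ) < p then Real.log p else Real.log (1 - p)

/-- `Z'(θ)`: as `Z(θ)`, with the two cases interchanged. -/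
def branchZ' (θ a b p : ℝ) : ℝ :=
  if a ^ θ / (a ^ θ + b ^ θ) < p then Real.log a else Real.log b

/-- `G(θ) = 𝔼 Y₁(θ) / 𝔼 Z₁(θ)`. -/
def moranG {Ω : Type*} [MeasurableSpace Ω] (P : Measure Ω)
    (a b : ℕ → Ω → ℝ) (p : ℕ → Ω → I) (θ : ℝ) : ℝ :=
  (∫ ω, branchY θ (a 0 ω) (b 0 ω) (p 0 ω) ∂P) / (∫ ω, branchZ θ (a 0 ω) (b 0 ω) (p 0 ω) ∂P)

/-- `G'(θ) = 𝔼 Y'₁(θ) / 𝔼 Z'₁(θ)`. -/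
def moranG' {Ω : Type*} [MeasurableSpace Ω] (P : Measure Ω)
    (a b : ℕ → Ω → ℝ) (p : ℕ → Ω → I) (θ : ℝ) : ℝ :=
  (∫ ω, branchY' θ (a 0 ω) (b 0 ω) (p 0 ω) ∂P) / (∫ ω, branchZ' θ (a 0 ω) (b 0 ω) (p 0 ω) ∂P)

end

/-!
Write `W = Y - ψ Z` for the smaller, and `W' = Y' - ψ Z'` for the larger, of the two weights
`log p - ψ log a` and `log (1 - p) - ψ log b` of a level; the sign of `𝔼 W` (of `𝔼 W'`) is that of
`ψ - G(ψ)` (of `ψ - G'(ψ)`). The quotient `μ(I) / |I| ^ ψ` changes from a Moran interval `I` to a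
descendant by the exponential of the sum of the weights of the branches taken. As siblings are
separated by gaps proportional to the length of their parent, balls and Moran intervals of
comparable size are interchangeable (`real_ball_le_moranMass`, `moranMass_le_real_ball`).

If `𝔼 W > 0`, the Chernoff bound and the Borel-Cantelli lemma show that almost surely the sums of
`W` over all late blocks `[N, M)` with `M - N ≥ K log N` are nonnegative (`ae_sum_Ico_nonpos`). For
a large dimension function, the condition `r < R ^ (1 + Φ R)` says that `log (R / r)` exceeds
`H(R) log |log R|` with `H(R) → ∞`, so the levels `N` and `M` of the scales `R` and `r` are
eventually that far apart, whatever `H` is (`exists_scale_forall_levels`); hence `ψ` itself is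
admissible for the upper dimension on a set of full measure that does not depend on `Φ`. If
`𝔼 W' < 0`, the same argument with the inequalities reversed makes `ψ` admissible for the lower
dimension.

If `𝔼 W ≤ 0`, follow at each level the branch that realizes `W`. By the strong law of large numbers
the masses of the intervals `I` around the point so obtained are at most `|I| ^ (ψ - o(1))`, and
letting `r → 0` for one fixed `R` excludes every exponent below `ψ`; for `𝔼 W' ≥ 0` the branch that
realizes `W'` excludes every exponent above `ψ` for the lower dimension.
-/

/-! ### Independent pairs and a uniform large deviation bound -/

/-- Two independent sequences, each consisting of independent variables, form a sequence of
independent pairs. -/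
theorem iIndepFun_prodMk_of_indepFun {Ω ι E F : Type*} [MeasurableSpace Ω] [MeasurableSpace E]
    [MeasurableSpace F] {P : Measure Ω} [IsProbabilityMeasure P] {X : ι → Ω → E} {Y : ι → Ω → F}
    (hXm : ∀ i, Measurable (X i)) (hYm : ∀ i, Measurable (Y i))
    (hX : iIndepFun X P) (hY : iIndepFun Y P)
    (hXY : IndepFun (fun ω i => X i ω) (fun ω i => Y i ω) P) :
    iIndepFun (fun i ω => (X i ω, Y i ω)) P := by
  let π : ι → Set (Set Ω) := fun i =>
    {s | ∃ u v, MeasurableSet u ∧ MeasurableSet v ∧ X i ⁻¹' u ∩ Y i ⁻¹' v = s}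
  refine iIndepSets.iIndep (π := π) (fun i => ((hXm i).prodMk (hYm i)).comap_le) ?_ ?_ ?_
  · rintro i _ ⟨u, v, hu, hv, rfl⟩ _ ⟨u', v', hu', hv', rfl⟩ -
    refine ⟨u ∩ u', v ∩ v', hu.inter hu', hv.inter hv', ?_⟩
    ext ω
    simp only [mem_inter_iff, mem_preimage]
    tauto
  · intro i
    rw [← generateFrom_prod, MeasurableSpace.comap_generateFrom]
    congr 1
    ext s
    constructor
    · rintro ⟨_, ⟨u, hu, v, hv, rfl⟩, rfl⟩
      exact ⟨u, v, hu, hv, rfl⟩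
    · rintro ⟨u, v, hu, hv, rfl⟩
      exact ⟨u ×ˢ v, ⟨u, hu, v, hv, rfl⟩, rfl⟩
  · rw [iIndepSets_iff]
    intro S f hf
    choose! u v hu hv huv using hf
    have hS : ⋂ i ∈ S, f i = ((fun ω i => X i ω) ⁻¹' (S : Set ι).pi u) ∩
        ((fun ω i => Y i ω) ⁻¹' (S : Set ι).pi v) := by
      ext ω
      simp only [mem_iInter, mem_inter_iff, mem_preimage, Set.mem_pi, Finset.mem_coe]
      constructor
      · intro h
        refine ⟨fun i hi => ?_, fun i hi => ?_⟩ <;> have := h i hi <;> rw [← huv i hi] at this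
        exacts [this.1, this.2]
      · intro h i hi
        rw [← huv i hi]
        exact ⟨h.1 i hi, h.2 i hi⟩
    have hXS : (fun ω i => X i ω) ⁻¹' (S : Set ι).pi u = ⋂ i ∈ S, X i ⁻¹' u i := by
      ext ω; simp
    have hYS : (fun ω i => Y i ω) ⁻¹' (S : Set ι).pi v = ⋂ i ∈ S, Y i ⁻¹' v i := by
      ext ω; simp
    rw [hS, hXY.measure_inter_preimage_eq_mul _ _
        (MeasurableSet.pi S.countable_toSet fun i hi => hu i hi)
        (MeasurableSet.pi S.countable_toSet fun i hi => hv i hi), hXS, hYS,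
      hX.measure_inter_preimage_eq_mul S hu, hY.measure_inter_preimage_eq_mul S hv,
      ← Finset.prod_mul_distrib]
    refine Finset.prod_congr rfl fun i hi => ?_
    rw [← huv i hi]
    have hi' : IndepFun (X i) (Y i) P :=
      hXY.comp (measurable_pi_apply i) (measurable_pi_apply i)
    exact (hi'.measure_inter_preimage_eq_mul _ _ (hu i hi) (hv i hi)).symm

/-- A variable with negative mean and exponential moments has `𝔼 exp (s X) < 1` for some `s > 0`,
because the derivative of its moment generating function at `0` is its mean. -/
theorem exists_mgf_lt_one {Ω : Type*} [MeasurableSpace Ω] {P : Measure Ω}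
    [IsProbabilityMeasure P] {X : Ω → ℝ} (h0 : 0 ∈ interior (integrableExpSet X P))
    (hneg : ∫ ω, X ω ∂P < 0) : ∃ s, 0 < s ∧ s ∈ integrableExpSet X P ∧ mgf X P s < 1 := by
  have hd : HasDerivAt (mgf X P) (∫ ω, X ω ∂P) 0 := by
    simpa using hasDerivAt_mgf h0
  have h1 : ∀ᶠ s in 𝓝[>] (0 : ℝ), mgf X P s < 1 := by
    have h2 := hd.tendsto_slope_zero_right.eventually_lt_const hneg
    filter_upwards [h2, self_mem_nhdsWithin] with s hs hs0
    have hs0 : 0 < s := hs0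
    rw [zero_add, mgf_zero, smul_eq_mul] at hs
    by_contra! hle
    have : 0 ≤ s⁻¹ * (mgf X P s - 1) := mul_nonneg (inv_nonneg.2 hs0.le) (by linarith)
    linarith
  have h3 : ∀ᶠ s in 𝓝[>] (0 : ℝ), s ∈ integrableExpSet X P :=
    nhdsWithin_le_nhds (mem_interior_iff_mem_nhds.1 h0)
  obtain ⟨s, ⟨hs1, hs2⟩, hs0⟩ := ((h1.and h3).and self_mem_nhdsWithin).exists
  exact ⟨s, hs0, hs2, hs1⟩

/-- For i.i.d. variables with negative mean and exponential moments, almost surely every block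
sum over `[N, M)` is nonpositive as soon as `N` is large and the block has length at least
`K log N`. The Chernoff bound makes the probability of a positive sum at most `q ^ (M - N)` with
`q < 1`, and `K` is such that these bounds are summable over all such blocks. -/
theorem ae_sum_Ico_nonpos {Ω : Type*} [MeasurableSpace Ω] {P : Measure Ω}
    [IsProbabilityMeasure P] {X : ℕ → Ω → ℝ} (hm : ∀ n, Measurable (X n)) (hind : iIndepFun X P)
    (hid : ∀ n, IdentDistrib (X n) (X 0) P P) (h0 : 0 ∈ interior (integrableExpSet (X 0) P))
    (hneg : ∫ ω, X 0 ω ∂P < 0) :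
    ∃ K : ℝ, 0 < K ∧ ∀ᵐ ω ∂P, ∃ N₀ : ℕ, ∀ N M : ℕ, N₀ ≤ N → N ≤ M →
      K * Real.log N ≤ (M : ℝ) - N → ∑ i ∈ Finset.Ico N M, X i ω ≤ 0 := by
  obtain ⟨s, hs0, hsI, hs1⟩ := exists_mgf_lt_one h0 hneg
  set q := mgf (X 0) P s with hq
  have hq0 : 0 < q := mgf_pos hsI
  have hlq : Real.log q < 0 := Real.log_neg hq0 hs1
  have hId : ∀ i, Integrable (fun ω => Real.exp (s * X i ω)) P := fun i =>
    ((hid i).comp (u := fun x => Real.exp (s * x)) (by fun_prop)).integrable_iff.2 hsI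
  have hchern : ∀ N M : ℕ, P {ω | 0 < ∑ i ∈ Finset.Ico N M, X i ω} ≤
      ENNReal.ofReal (q ^ (M - N)) := by
    intro N M
    have h1 : Integrable (fun ω => Real.exp (s * (∑ i ∈ Finset.Ico N M, X i) ω)) P :=
      hind.integrable_exp_mul_sum hm fun i _ => hId i
    have h2 := measure_ge_le_exp_mul_mgf (μ := P) 0 hs0.le h1
    rw [hind.mgf_sum hm, Finset.prod_congr rfl fun i _ => mgf_congr_of_identDistrib _ _ (hid i) s]
      at h2
    simp only [mul_zero, Real.exp_zero, one_mul, Finset.prod_const, Nat.card_Ico] at h2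
    rw [← hq, measureReal_def] at h2
    refine le_trans (measure_mono ?_) ((ENNReal.le_ofReal_iff_toReal_le (measure_ne_top _ _)
      (by positivity)).2 h2)
    intro ω hω
    simpa using le_of_lt hω
  -- `q ^ (K log N) = N ^ (-2)` for this value of `K`
  refine ⟨2 / (-Real.log q), by apply div_pos <;> linarith, ?_⟩
  set K := 2 / (-Real.log q) with hK
  let bad : ℕ → Set Ω := fun N => ⋃ k : ℕ,
    {ω | K * Real.log N ≤ k ∧ 0 < ∑ i ∈ Finset.Ico N (N + k), X i ω}
  have hbad : ∀ N : ℕ, 1 ≤ N → P (bad N) ≤ ENNReal.ofReal (((N : ℝ) ^ 2)⁻¹ * (1 - q)⁻¹) := by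
    intro N hN
    have hNpos : (0 : ℝ) < N := by exact_mod_cast hN
    set k₀ := ⌈K * Real.log N⌉₊ with hk₀
    have hsub : bad N ⊆ ⋃ j : ℕ, {ω | 0 < ∑ i ∈ Finset.Ico N (N + (k₀ + j)), X i ω} := by
      intro ω hω
      obtain ⟨k, hk1, hk2⟩ := mem_iUnion.1 hω
      have : k₀ ≤ k := Nat.ceil_le.2 hk1
      refine mem_iUnion.2 ⟨k - k₀, ?_⟩
      rwa [Nat.add_sub_cancel' this]
    have hg : HasSum (fun j : ℕ => q ^ (k₀ + j)) (q ^ k₀ * (1 - q)⁻¹) := by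
      simpa [pow_add] using (hasSum_geometric_of_lt_one hq0.le hs1).mul_left (q ^ k₀)
    have hle : q ^ k₀ ≤ ((N : ℝ) ^ 2)⁻¹ := by
      rw [← Real.log_le_log_iff (by positivity) (by positivity), Real.log_pow, Real.log_inv,
        Real.log_pow]
      have h1 : K * Real.log N ≤ k₀ := Nat.le_ceil _
      have h2 : K * Real.log q = -2 := by
        rw [hK, div_neg, neg_mul, div_mul_cancel₀ _ hlq.ne]
      have h3 := mul_le_mul_of_nonpos_right h1 hlq.le
      rw [mul_right_comm, h2] at h3
      push_cast
      linarith
    calc P (bad N) ≤ ∑' j : ℕ, P {ω | 0 < ∑ i ∈ Finset.Ico N (N + (k₀ + j)), X i ω} :=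
          (measure_mono hsub).trans (measure_iUnion_le _)
      _ ≤ ∑' j : ℕ, ENNReal.ofReal (q ^ (k₀ + j)) := by
          gcongr with j
          simpa using hchern N (N + (k₀ + j))
      _ = ENNReal.ofReal (q ^ k₀ * (1 - q)⁻¹) := by
          rw [← ENNReal.ofReal_tsum_of_nonneg (fun j => by positivity) hg.summable, hg.tsum_eq]
      _ ≤ _ := by
          have : 0 ≤ (1 - q)⁻¹ := inv_nonneg.2 (by linarith)
          gcongr
  have hsum : ∑' N, P (bad (N + 1)) ≠ ∞ := by
    have hs : Summable fun N : ℕ => (((N + 1 : ℕ) : ℝ) ^ 2)⁻¹ * (1 - q)⁻¹ :=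
      ((summable_nat_add_iff 1).2 (Real.summable_nat_pow_inv.2 one_lt_two)).mul_right _
    have hq' : 0 ≤ (1 - q)⁻¹ := inv_nonneg.2 (by linarith)
    refine ne_top_of_le_ne_top ?_ (ENNReal.tsum_le_tsum fun N => hbad (N + 1) (by omega))
    rw [← ENNReal.ofReal_tsum_of_nonneg (fun N => by positivity) hs]
    exact ENNReal.ofReal_ne_top
  filter_upwards [ae_eventually_notMem hsum] with ω hω
  obtain ⟨N₁, hN₁⟩ := eventually_atTop.1 hω
  refine ⟨N₁ + 1, fun N M hN hNM hK' => ?_⟩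
  obtain ⟨n, rfl⟩ : ∃ n, N = n + 1 := ⟨N - 1, by omega⟩
  by_contra! hpos
  refine hN₁ n (by omega) (mem_iUnion.2 ⟨M - (n + 1), ?_, ?_⟩)
  · rwa [Nat.cast_sub hNM]
  · rwa [Nat.add_sub_cancel' hNM]

/-! ### Moran intervals and balls -/

/-- The pathwise assumptions on the ratios and probabilities of a Moran construction: ratios
bounded below by `A` with sum at most `B < 1`, and nondegenerate probabilities. -/
structure IsMoranData (A B : ℝ) (a b : ℕ → ℝ) (p : ℕ → I) : Prop where
  A_pos : 0 < A
  B_lt_one : B < 1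
  le_a : ∀ n, A ≤ a n
  le_b : ∀ n, A ≤ b n
  add_le : ∀ n, a n + b n ≤ B
  p_pos : ∀ n, 0 < (p n : ℝ)
  p_lt_one : ∀ n, (p n : ℝ) < 1

/-- The conditional probability of digit number `i` of the address `v`. -/
def branchProb (p : ℕ → I) (v : ℕ → Bool) (i : ℕ) : ℝ := if v i then 1 - (p i : ℝ) else p i

/-- The contraction ratio of digit number `i` of the address `v`. -/
def branchRatio (a b : ℕ → ℝ) (v : ℕ → Bool) (i : ℕ) : ℝ := if v i then b i else a i

/-- The mass of the level `N` Moran interval with address `v`. -/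
def moranMass (p : ℕ → I) (v : ℕ → Bool) (N : ℕ) : ℝ := ∏ i ∈ Finset.range N, branchProb p v i

theorem moranLength_succ (a b : ℕ → ℝ) (v : ℕ → Bool) (N : ℕ) :
    moranLength a b v (N + 1) = moranLength a b v N * branchRatio a b v N := rfl

namespace IsMoranData

variable {A B : ℝ} {a b : ℕ → ℝ} {p : ℕ → I} (h : IsMoranData A B a b p)

include h

theorem a_pos (n : ℕ) : 0 < a n := h.A_pos.trans_le (h.le_a n)

theorem b_pos (n : ℕ) : 0 < b n := h.A_pos.trans_le (h.le_b n)

theorem add_lt (n : ℕ) : a n + b n < 1 := (h.add_le n).trans_lt h.B_lt_one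

theorem A_le_B : A ≤ B := by linarith [h.le_a 0, h.b_pos 0, h.add_le 0]

theorem B_pos : 0 < B := h.A_pos.trans_le h.A_le_B

theorem A_lt_one : A < 1 := h.A_le_B.trans_lt h.B_lt_one

theorem A_le_branchRatio (v : ℕ → Bool) (i : ℕ) : A ≤ branchRatio a b v i := by
  unfold branchRatio
  split_ifs
  exacts [h.le_b i, h.le_a i]

theorem branchRatio_le_B (v : ℕ → Bool) (i : ℕ) : branchRatio a b v i ≤ B := by
  unfold branchRatio
  split_ifs <;> linarith [h.a_pos i, h.b_pos i, h.add_le i]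

theorem branchRatio_pos (v : ℕ → Bool) (i : ℕ) : 0 < branchRatio a b v i :=
  h.A_pos.trans_le (h.A_le_branchRatio v i)

theorem branchProb_pos (v : ℕ → Bool) (i : ℕ) : 0 < branchProb p v i := by
  unfold branchProb
  split_ifs
  exacts [sub_pos.2 (h.p_lt_one i), h.p_pos i]

theorem moranMass_pos (v : ℕ → Bool) (N : ℕ) : 0 < moranMass p v N :=
  Finset.prod_pos fun i _ => h.branchProb_pos v i

theorem length_pos (v : ℕ → Bool) (N : ℕ) : 0 < moranLength a b v N :=
  moranLength_pos h.a_pos h.b_pos v N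

theorem mul_length_le_succ (v : ℕ → Bool) (N : ℕ) :
    A * moranLength a b v N ≤ moranLength a b v (N + 1) := by
  rw [moranLength_succ, mul_comm]
  exact mul_le_mul_of_nonneg_left (h.A_le_branchRatio v N) (h.length_pos v N).le

theorem length_succ_le_mul (v : ℕ → Bool) (N : ℕ) :
    moranLength a b v (N + 1) ≤ B * moranLength a b v N := by
  rw [moranLength_succ, mul_comm B]
  exact mul_le_mul_of_nonneg_left (h.branchRatio_le_B v N) (h.length_pos v N).le

theorem antitone_length (v : ℕ → Bool) : Antitone (moranLength a b v) :=
  antitone_nat_of_succ_le fun N => (h.length_succ_le_mul v N).trans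
    (mul_le_of_le_one_left (h.length_pos v N).le h.B_lt_one.le)

theorem pow_mul_length_le (v : ℕ → Bool) (N k : ℕ) :
    A ^ k * moranLength a b v N ≤ moranLength a b v (N + k) := by
  induction k with
  | zero => simp
  | succ k ih =>
    calc A ^ (k + 1) * moranLength a b v N = A * (A ^ k * moranLength a b v N) := by ring
      _ ≤ A * moranLength a b v (N + k) := mul_le_mul_of_nonneg_left ih h.A_pos.le
      _ ≤ _ := h.mul_length_le_succ v (N + k)

theorem length_le_pow (v : ℕ → Bool) (N : ℕ) : moranLength a b v N ≤ B ^ N := by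
  induction N with
  | zero => simp [moranLength]
  | succ N ih =>
    rw [pow_succ']
    exact (h.length_succ_le_mul v N).trans (mul_le_mul_of_nonneg_left ih h.B_pos.le)

theorem tendsto_length (v : ℕ → Bool) : Tendsto (moranLength a b v) atTop (𝓝 0) :=
  squeeze_zero (fun N => (h.length_pos v N).le) (h.length_le_pow v)
    (tendsto_pow_atTop_nhds_zero_of_lt_one h.B_pos.le h.B_lt_one)

/-- Every scale `s ≤ 1` lies between the lengths of two successive Moran intervals. -/
theorem exists_level (v : ℕ → Bool) {s : ℝ} (hs : 0 < s) (hs1 : s ≤ 1) :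
    ∃ N, moranLength a b v (N + 1) < s ∧ s ≤ moranLength a b v N := by
  classical
  have hex : ∃ N, moranLength a b v N < s :=
    ((h.tendsto_length v).eventually_lt_const hs).exists
  obtain ⟨n, hn⟩ : ∃ n, Nat.find hex = n + 1 := by
    refine Nat.exists_eq_succ_of_ne_zero fun h0 => ?_
    have := Nat.find_spec hex
    rw [h0, moranLength] at this
    linarith
  exact ⟨n, hn ▸ Nat.find_spec hex, not_lt.1 (Nat.find_min hex (by omega))⟩

theorem log_mass_sub_mul_log_length (ψ : ℝ) (v : ℕ → Bool) (N : ℕ) :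
    Real.log (moranMass p v N) - ψ * Real.log (moranLength a b v N) =
      ∑ i ∈ Finset.range N,
        (Real.log (branchProb p v i) - ψ * Real.log (branchRatio a b v i)) := by
  induction N with
  | zero => simp [moranMass, moranLength]
  | succ N ih =>
    rw [Finset.sum_range_succ, ← ih, moranLength_succ, moranMass, Finset.prod_range_succ,
      ← moranMass, Real.log_mul (h.moranMass_pos v N).ne' (h.branchProb_pos v N).ne',
      Real.log_mul (h.length_pos v N).ne' (h.branchRatio_pos v N).ne']
    ring

theorem real_moranInterval (v : ℕ → Bool) (N : ℕ) :
    (moranMeasure a b p).real (moranInterval a b v N) = moranMass p v N := by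
  rw [measureReal_def, moranMeasure_moranInterval h.a_pos h.b_pos h.add_lt, ENNReal.toReal_prod,
    moranMass]
  exact Finset.prod_congr rfl fun i _ => ENNReal.toReal_ofReal (h.branchProb_pos v i).le

/-- The two children of a Moran interval of length `s` are at distance at least `(1 - B) s`. -/
theorem moranPoint_mem_of_dist_lt {v w : ℕ → Bool} {N : ℕ}
    (hd : dist (moranPoint a b w) (moranPoint a b v) < (1 - B) * moranLength a b v N) :
    moranPoint a b w ∈ moranInterval a b v N := by
  rw [moranPoint_mem_iff h.a_pos h.b_pos h.add_lt]
  intro i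
  induction i using Nat.strong_induction_on with
  | _ i ih =>
    intro hi
    obtain ⟨h1, h2⟩ := moran_congr a b fun j hj => ih j hj (hj.trans hi)
    have hL := h.length_pos v i
    have hant := h.antitone_length v hi.le
    have hw := moranPoint_mem h.a_pos h.b_pos h.add_lt w (i + 1)
    have hv := moranPoint_mem h.a_pos h.b_pos h.add_lt v (i + 1)
    have hB := h.B_lt_one
    have hab := h.add_le i
    have hd' := hd.trans_le (mul_le_mul_of_nonneg_left hant (by linarith))
    rw [Real.dist_eq, abs_lt] at hd'
    simp only [moranInterval, moranLeft, moranLength, mem_Icc, h1, h2] at hw hv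
    cases hwi : w i <;> cases hvi : v i <;> simp [hwi, hvi] at hw hv ⊢ <;> nlinarith

theorem moranInterval_subset_ball {v : ℕ → Bool} {N : ℕ} {r : ℝ} (hr : moranLength a b v N < r) :
    moranInterval a b v N ⊆ Metric.ball (moranPoint a b v) r := by
  intro y hy
  have hx := moranPoint_mem h.a_pos h.b_pos h.add_lt v N
  rw [Metric.mem_ball, Real.dist_eq, abs_lt]
  constructor <;> linarith [hx.1, hx.2, hy.1, hy.2]

theorem moranMass_le_real_ball {v : ℕ → Bool} {N : ℕ} {r : ℝ} (hr : moranLength a b v N < r) :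
    moranMass p v N ≤ (moranMeasure a b p).real (Metric.ball (moranPoint a b v) r) := by
  rw [← h.real_moranInterval]
  exact measureReal_mono (h.moranInterval_subset_ball hr)

theorem real_ball_le_moranMass {v : ℕ → Bool} {N : ℕ} {r : ℝ}
    (hr : r ≤ (1 - B) * moranLength a b v N) :
    (moranMeasure a b p).real (Metric.ball (moranPoint a b v) r) ≤ moranMass p v N := by
  rw [← h.real_moranInterval]
  refine ENNReal.toReal_mono (measure_ne_top _ _) ?_
  have hI : MeasurableSet (moranInterval a b v N) := measurableSet_Icc
  rw [moranMeasure, Measure.map_apply (measurable_moranPoint a b) measurableSet_ball,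
    Measure.map_apply (measurable_moranPoint a b) hI]
  exact measure_mono fun w hw => h.moranPoint_mem_of_dist_lt (lt_of_lt_of_le hw hr)

theorem real_ball_pos (v : ℕ → Bool) {r : ℝ} (hr : 0 < r) :
    0 < (moranMeasure a b p).real (Metric.ball (moranPoint a b v) r) := by
  obtain ⟨N, hN⟩ := ((h.tendsto_length v).eventually_lt_const hr).exists
  exact (h.moranMass_pos v N).trans_le (h.moranMass_le_real_ball hN)

theorem moranPoint_mem_support (v : ℕ → Bool) :
    moranPoint a b v ∈ (moranMeasure a b p).support := by
  rw [Metric.nhds_basis_ball.mem_measureSupport]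
  exact fun r hr => ENNReal.toReal_pos_iff.1 (h.real_ball_pos v hr) |>.1

theorem continuous_moranPoint : Continuous (moranPoint a b) := by
  rw [continuous_iff_continuousAt]
  intro v
  rw [ContinuousAt, Metric.tendsto_nhds]
  intro ε hε
  obtain ⟨N, hN⟩ := ((h.tendsto_length v).eventually_lt_const hε).exists
  have hopen : ∀ᶠ w in 𝓝 v, ∀ i < N, w i = v i := by
    refine (eventually_all_finite (finite_Iio N)).2 fun i _ => ?_
    exact (continuous_apply i).continuousAt.eventually
      (mem_nhds_discrete.2 rfl : ∀ᶠ c in 𝓝 (v i), c = v i)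
  filter_upwards [hopen] with w hw
  exact h.moranInterval_subset_ball hN
    ((moranPoint_mem_iff h.a_pos h.b_pos h.add_lt v w N).2 hw)

/-- The set of points with an address is compact and has full measure, so it contains the
support. -/
theorem exists_address_of_mem_support {x : ℝ} (hx : x ∈ (moranMeasure a b p).support) :
    ∃ v, moranPoint a b v = x := by
  have hc : IsClosed (range (moranPoint a b)) :=
    (isCompact_range h.continuous_moranPoint).isClosed
  refine Measure.support_subset_of_isClosed hc ?_ hx
  exact (ae_map_iff (measurable_moranPoint a b).aemeasurable hc.measurableSet).2
    (Eventually.of_forall fun v => mem_range_self v)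

end IsMoranData

/-! ### Criteria for the `Φ`-dimensions of a Moran measure -/

namespace IsMoranData

variable {A B : ℝ} {a b : ℕ → ℝ} {p : ℕ → I} (h : IsMoranData A B a b p)

include h

theorem log_mass_ratio_add_sum {ψ : ℝ} {v : ℕ → Bool} {N M : ℕ} (hNM : N ≤ M) :
    Real.log (moranMass p v N / moranMass p v M) +
        ∑ i ∈ Finset.Ico N M,
          (Real.log (branchProb p v i) - ψ * Real.log (branchRatio a b v i)) =
      Real.log ((moranLength a b v N / moranLength a b v M) ^ ψ) := by
  have hN := h.length_pos v N
  have hM := h.length_pos v M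
  rw [Finset.sum_Ico_eq_sub _ hNM, ← h.log_mass_sub_mul_log_length,
    ← h.log_mass_sub_mul_log_length, Real.log_rpow (by positivity),
    Real.log_div (h.moranMass_pos v N).ne' (h.moranMass_pos v M).ne', Real.log_div hN.ne' hM.ne']
  ring

theorem mass_ratio_le {ψ : ℝ} {v : ℕ → Bool} {N M : ℕ} (hNM : N ≤ M)
    (hs : 0 ≤ ∑ i ∈ Finset.Ico N M,
      (Real.log (branchProb p v i) - ψ * Real.log (branchRatio a b v i))) :
    moranMass p v N / moranMass p v M ≤ (moranLength a b v N / moranLength a b v M) ^ ψ := by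
  have h1 := div_pos (h.moranMass_pos v N) (h.moranMass_pos v M)
  have h2 := div_pos (h.length_pos v N) (h.length_pos v M)
  rw [← Real.log_le_log_iff h1 (Real.rpow_pos_of_pos h2 _), ← h.log_mass_ratio_add_sum hNM]
  linarith

theorem le_mass_ratio {ψ : ℝ} {v : ℕ → Bool} {N M : ℕ} (hNM : N ≤ M)
    (hs : ∑ i ∈ Finset.Ico N M,
      (Real.log (branchProb p v i) - ψ * Real.log (branchRatio a b v i)) ≤ 0) :
    (moranLength a b v N / moranLength a b v M) ^ ψ ≤ moranMass p v N / moranMass p v M := by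
  have h1 := div_pos (h.moranMass_pos v N) (h.moranMass_pos v M)
  have h2 := div_pos (h.length_pos v N) (h.length_pos v M)
  rw [← Real.log_le_log_iff (Real.rpow_pos_of_pos h2 _) h1, ← h.log_mass_ratio_add_sum hNM]
  linarith

/-- For a large dimension function, scales `r < R ^ (1 + Φ R)` with `R` small correspond, up to a
factor `D`, to levels `N ≤ M` whose difference exceeds any prescribed multiple of `log N`: the
level `N` is comparable to `|log R|` and the difference is at least a constant times
`log (R / r) > H(R) log |log R|`. -/
theorem exists_scale_forall_levels {Φ : ℝ → ℝ} (hΦ : IsLargeDimensionFunction Φ) {D K : ℝ}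
    (hD : 1 ≤ D) (hK : 0 < K) (N₀ : ℕ) :
    ∃ C : ℝ, 0 < C ∧ C < 1 ∧ ∀ R r : ℝ, 0 < r → r < R ^ (1 + Φ R) → 0 < R → R ≤ C →
      ∀ (v : ℕ → Bool) (N M : ℕ), R / D ≤ moranLength a b v N → moranLength a b v N ≤ D * R →
        moranLength a b v M ≤ D * r → N₀ ≤ N ∧ N ≤ M ∧ K * Real.log N ≤ (M : ℝ) - N := by
  obtain ⟨H, hH, hΦH⟩ := hΦ.large
  set α := -Real.log A with hα
  set β := -Real.log B with hβ
  set δ := Real.log D with hδ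
  have hα0 : 0 < α := neg_pos.2 (Real.log_neg h.A_pos h.A_lt_one)
  have hβ0 : 0 < β := neg_pos.2 (Real.log_neg h.B_pos h.B_lt_one)
  have hδ0 : 0 ≤ δ := Real.log_nonneg hD
  have hD0 : 0 < D := by linarith
  set c := (1 + δ) / β with hc
  have hc0 : 0 < c := by positivity
  have hx : Tendsto (fun R => -Real.log R) (𝓝[>] 0) atTop :=
    tendsto_neg_atBot_atTop.comp Real.tendsto_log_nhdsGT_zero
  have hev := hΦH.and <| (hH.eventually_ge_atTop (α * K * (1 + |Real.log c|) + 2 * δ)).and <|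
    (hx.eventually_ge_atTop (max 1 (δ + N₀ * α))).and
      ((Real.tendsto_log_atTop.comp hx).eventually_ge_atTop 1)
  obtain ⟨ε, hε, hεs⟩ := mem_nhdsGT_iff_exists_Ioo_subset.1 hev
  have hε : 0 < ε := hε
  refine ⟨min (ε / 2) (1 / 2), by positivity, (min_le_right _ _).trans_lt (by norm_num), ?_⟩
  intro R r hr hrR hR hRC v N M hN1 hN2 hM
  obtain ⟨hΦR, hHR, hxR, hyR⟩ := hεs ⟨hR, by linarith [hRC.trans (min_le_left _ _)]⟩
  simp only [Function.comp_apply] at hyR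
  set x := -Real.log R with hxdef
  have hx1 : 1 ≤ x := (le_max_left _ _).trans hxR
  have hx2 : δ + N₀ * α ≤ x := (le_max_right _ _).trans hxR
  have habs : |Real.log R| = x := abs_of_neg (by linarith)
  rw [habs] at hΦR
  set y := Real.log x with hy
  have hLN := h.length_pos v N
  have hLM := h.length_pos v M
  have e1 : Real.log r < -x - H R * y := by
    have := Real.log_lt_log hr hrR
    rw [Real.log_rpow hR, hΦR] at this
    have h2 : (1 + H R * (y / x)) * Real.log R = -x - H R * y := by
      rw [show Real.log R = -x by simp [x]]
      field_simp
      ring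
    linarith
  have e2 : -x - δ ≤ Real.log (moranLength a b v N) := by
    have := Real.log_le_log (by positivity) hN1
    rw [Real.log_div hR.ne' hD0.ne'] at this
    linarith
  have e3 : Real.log (moranLength a b v N) ≤ δ - x := by
    have := Real.log_le_log hLN hN2
    rw [Real.log_mul hD0.ne' hR.ne'] at this
    linarith
  have e4 : Real.log (moranLength a b v M) ≤ δ + Real.log r := by
    have := Real.log_le_log hLM hM
    rwa [Real.log_mul hD0.ne' hr.ne'] at this
  have e5 : Real.log (moranLength a b v N) ≤ -(N * β) := by
    have := Real.log_le_log hLN (h.length_le_pow v N)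
    rw [Real.log_pow] at this
    linarith
  have e6 : -(N * α) ≤ Real.log (moranLength a b v N) := by
    have h1 := h.pow_mul_length_le v 0 N
    rw [zero_add, moranLength, mul_one] at h1
    have := Real.log_le_log (pow_pos h.A_pos N) h1
    rw [Real.log_pow] at this
    linarith
  -- for `M < N` the truncated difference `M - N = 0` makes this bound true as well
  have e7 : -((M - N : ℕ) * α) + Real.log (moranLength a b v N) ≤
      Real.log (moranLength a b v M) := by
    have h1 : A ^ (M - N) * moranLength a b v N ≤ moranLength a b v M :=
      (h.pow_mul_length_le v N (M - N)).trans (h.antitone_length v (by omega))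
    have := Real.log_le_log (mul_pos (pow_pos h.A_pos _) hLN) h1
    rw [Real.log_mul (pow_pos h.A_pos _).ne' hLN.ne', Real.log_pow] at this
    linarith
  have hlogN : Real.log N ≤ y + |Real.log c| := by
    rcases Nat.eq_zero_or_pos N with rfl | hN0
    · simp only [Nat.cast_zero, Real.log_zero]
      positivity
    · have h1 : (N : ℝ) ≤ x * c := by
        rw [hc, ← mul_div_assoc, le_div_iff₀ hβ0]
        nlinarith
      have h2 := Real.log_le_log (by exact_mod_cast hN0) h1
      rw [Real.log_mul (by linarith) hc0.ne'] at h2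
      linarith [le_abs_self (Real.log c)]
  have e8 : α * (K * (y + |Real.log c|)) < α * (M - N : ℕ) := by
    have h1 : H R * y - 2 * δ < α * (M - N : ℕ) := by linarith
    have h2 := mul_le_mul_of_nonneg_right hHR (by linarith : 0 ≤ y)
    have h3 : 0 ≤ (α * K * |Real.log c| + 2 * δ) * (y - 1) :=
      mul_nonneg (by positivity) (by linarith)
    linarith
  have e9 := lt_of_mul_lt_mul_left e8 hα0.le
  have hNM : N < M := by
    by_contra! hle
    rw [Nat.sub_eq_zero_of_le hle, Nat.cast_zero] at e9
    have : 0 ≤ K * (y + |Real.log c|) := by positivity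
    linarith
  refine ⟨?_, hNM.le, ?_⟩
  · have : (N₀ : ℝ) * α ≤ N * α := by linarith
    exact_mod_cast le_of_mul_le_mul_right this hα0
  · rw [Nat.cast_sub hNM.le] at e9
    exact (mul_le_mul_of_nonneg_left hlogN hK.le).trans e9.le

/-- If the smaller of the two weights at each level has nonnegative sums over all late blocks of
length at least `K log N`, then `ψ` is an admissible exponent for the upper `Φ`-dimension. -/
theorem upperPhiDim_le {ψ : ℝ} (hψ : 0 ≤ ψ) {Φ : ℝ → ℝ} (hΦ : IsLargeDimensionFunction Φ)
    {W : ℕ → ℝ}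
    (hW : ∀ v i, W i ≤ Real.log (branchProb p v i) - ψ * Real.log (branchRatio a b v i))
    {K : ℝ} (hK : 0 < K) {N₀ : ℕ}
    (hsum : ∀ N M : ℕ, N₀ ≤ N → N ≤ M → K * Real.log N ≤ (M : ℝ) - N →
      0 ≤ ∑ i ∈ Finset.Ico N M, W i) :
    upperPhiDim Φ (moranMeasure a b p) ≤ (ψ : EReal) := by
  have hA := h.A_pos
  have hA1 := h.A_lt_one
  have hB0 := h.B_pos
  have hB : 0 < 1 - B := sub_pos.2 h.B_lt_one
  -- `1 - B` and `A` bound the sizes of a gap and of a child relative to the parent from below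
  set D := ((1 - B) * A)⁻¹ with hD
  have hD1 : 1 ≤ D := (one_le_inv₀ (by positivity)).2 (by nlinarith)
  have hD0 : 0 < D := by linarith
  obtain ⟨C, hC0, hC1, hC⟩ := h.exists_scale_forall_levels hΦ hD1 hK N₀
  refine sInf_le ⟨ψ, ⟨min C (1 - B), (D * D) ^ ψ, by positivity,
    (min_le_left _ _).trans_lt hC1, by positivity, ?_⟩, rfl⟩
  intro R r hr hrR hR hRle hRC x hx
  obtain ⟨v, rfl⟩ := h.exists_address_of_mem_support hx
  have hRB : R ≤ 1 - B := hRC.trans (min_le_right _ _)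
  obtain ⟨N, hN1, hN2⟩ := h.exists_level v (s := R / (1 - B)) (by positivity)
    (by rwa [div_le_one hB])
  obtain ⟨M, hM1, hM2⟩ := h.exists_level v hr (by linarith : r ≤ 1)
  have hAN := h.mul_length_le_succ v N
  have hAM := h.mul_length_le_succ v M
  rw [div_le_iff₀ hB] at hN2
  rw [lt_div_iff₀ hB] at hN1
  have hLN := h.length_pos v N
  have hLM := h.length_pos v (M + 1)
  have hN3 : moranLength a b v N ≤ D * R := by
    rw [hD, inv_mul_eq_div, le_div_iff₀ (by positivity)]
    nlinarith
  have hN4 : R / D ≤ moranLength a b v N := by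
    rw [div_le_iff₀ hD0]
    nlinarith
  have hM3 : moranLength a b v (M + 1) ≤ D * r := by nlinarith
  have hM4 : r ≤ D * moranLength a b v (M + 1) := by
    rw [hD, inv_mul_eq_div, le_div_iff₀ (by positivity)]
    linarith [mul_pos (mul_pos hr hA) hB0, mul_le_mul_of_nonneg_left hM2 hA.le]
  obtain ⟨hN0, hNM, hlog⟩ := hC R r hr hrR hR (hRC.trans (min_le_left _ _)) v N (M + 1)
    hN4 hN3 hM3
  have hs := (hsum N (M + 1) hN0 hNM hlog).trans (Finset.sum_le_sum fun i _ => hW v i)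
  calc (moranMeasure a b p).real (Metric.ball (moranPoint a b v) R) /
        (moranMeasure a b p).real (Metric.ball (moranPoint a b v) r)
      ≤ moranMass p v N / moranMass p v (M + 1) :=
        div_le_div₀ (h.moranMass_pos v N).le (h.real_ball_le_moranMass (by linarith))
          (h.moranMass_pos v (M + 1)) (h.moranMass_le_real_ball hM1)
    _ ≤ (moranLength a b v N / moranLength a b v (M + 1)) ^ ψ := h.mass_ratio_le hNM hs
    _ ≤ (D * D * (R / r)) ^ ψ := by
        refine Real.rpow_le_rpow (by positivity) ?_ hψ
        rw [← mul_div_assoc, div_le_div_iff₀ hLM hr]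
        calc _ ≤ D * R * (D * moranLength a b v (M + 1)) :=
              mul_le_mul hN3 hM4 hr.le (by positivity)
          _ = _ := by ring
    _ = _ := Real.mul_rpow (by positivity) (by positivity)

/-- If the larger of the two weights at each level has nonpositive sums over all late blocks of
length at least `K log N`, then `ψ` is an admissible exponent for the lower `Φ`-dimension. -/
theorem le_lowerPhiDim {ψ : ℝ} (hψ : 0 ≤ ψ) {Φ : ℝ → ℝ} (hΦ : IsLargeDimensionFunction Φ)
    {W : ℕ → ℝ}
    (hW : ∀ v i, Real.log (branchProb p v i) - ψ * Real.log (branchRatio a b v i) ≤ W i)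
    {K : ℝ} (hK : 0 < K) {N₀ : ℕ}
    (hsum : ∀ N M : ℕ, N₀ ≤ N → N ≤ M → K * Real.log N ≤ (M : ℝ) - N →
      ∑ i ∈ Finset.Ico N M, W i ≤ 0) :
    (ψ : EReal) ≤ lowerPhiDim Φ (moranMeasure a b p) := by
  have hA := h.A_pos
  have hA1 := h.A_lt_one
  have hB0 := h.B_pos
  have hB : 0 < 1 - B := sub_pos.2 h.B_lt_one
  -- `1 - B` and `A` bound the sizes of a gap and of a child relative to the parent from below
  set D := ((1 - B) * A)⁻¹ with hD
  have hD1 : 1 ≤ D := (one_le_inv₀ (by positivity)).2 (by nlinarith)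
  have hD0 : 0 < D := by linarith
  obtain ⟨C, hC0, hC1, hC⟩ := h.exists_scale_forall_levels hΦ hD1 hK N₀
  refine le_sSup ⟨ψ, ⟨min C (1 - B), ((D * D)⁻¹) ^ ψ, by positivity,
    (min_le_left _ _).trans_lt hC1, by positivity, ?_⟩, rfl⟩
  intro R r hr hrR hR hRle hRC x hx
  obtain ⟨v, rfl⟩ := h.exists_address_of_mem_support hx
  have hRB : R ≤ 1 - B := hRC.trans (min_le_right _ _)
  obtain ⟨N, hN1, hN2⟩ := h.exists_level v hR (by linarith : R ≤ 1)
  obtain ⟨M, hM1, hM2⟩ := h.exists_level v (s := r / (1 - B)) (by positivity)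
    (by rw [div_le_one hB]; linarith)
  have hAN := h.mul_length_le_succ v N
  have hAM := h.mul_length_le_succ v M
  rw [div_le_iff₀ hB] at hM2
  rw [lt_div_iff₀ hB] at hM1
  have hLN := h.length_pos v (N + 1)
  have hLM := h.length_pos v M
  have hN3 : moranLength a b v (N + 1) ≤ D * R := by nlinarith
  have hN4 : R ≤ D * moranLength a b v (N + 1) := by
    rw [hD, inv_mul_eq_div, le_div_iff₀ (by positivity)]
    linarith [mul_pos (mul_pos hR hA) hB0, mul_le_mul_of_nonneg_left hN2 hA.le]
  have hM3 : moranLength a b v M ≤ D * r := by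
    rw [hD, inv_mul_eq_div, le_div_iff₀ (by positivity)]
    nlinarith
  obtain ⟨hN0, hNM, hlog⟩ := hC R r hr hrR hR (hRC.trans (min_le_left _ _)) v (N + 1) M
    (by rwa [div_le_iff₀' hD0]) hN3 hM3
  have hs := (Finset.sum_le_sum fun i _ => hW v i).trans (hsum (N + 1) M hN0 hNM hlog)
  calc ((D * D)⁻¹) ^ ψ * (R / r) ^ ψ = ((D * D)⁻¹ * (R / r)) ^ ψ :=
        (Real.mul_rpow (by positivity) (by positivity)).symm
    _ ≤ (moranLength a b v (N + 1) / moranLength a b v M) ^ ψ := by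
        refine Real.rpow_le_rpow (by positivity) ?_ hψ
        rw [inv_mul_eq_div, div_div, div_le_div_iff₀ (by positivity) hLM]
        calc _ ≤ D * moranLength a b v (N + 1) * (D * r) :=
              mul_le_mul hN4 hM3 hLM.le (by positivity)
          _ = _ := by ring
    _ ≤ moranMass p v (N + 1) / moranMass p v M := h.le_mass_ratio hNM hs
    _ ≤ _ := div_le_div₀ measureReal_nonneg (h.moranMass_le_real_ball hN1)
          (h.real_ball_pos v hr) (h.real_ball_le_moranMass (by linarith))

/-- If the weights along some address have averages with nonpositive upper limit, then the balls
around the point with that address rule out all exponents below `ψ`. -/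
theorem le_upperPhiDim {ψ : ℝ} {Φ : ℝ → ℝ} (hΦ : IsDimensionFunction Φ) {v : ℕ → Bool}
    (hv : ∀ ε > 0, ∀ᶠ N : ℕ in atTop, ∑ i ∈ Finset.range N,
      (Real.log (branchProb p v i) - ψ * Real.log (branchRatio a b v i)) ≤ ε * N) :
    (ψ : EReal) ≤ upperPhiDim Φ (moranMeasure a b p) := by
  refine le_sInf ?_
  rintro _ ⟨d, ⟨C₁, C₂, hC₁, hC₁', hC₂, hd⟩, rfl⟩
  refine EReal.coe_le_coe_iff.2 ?_
  by_contra! hlt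
  have hB : 0 < 1 - B := sub_pos.2 h.B_lt_one
  have hlB : Real.log B < 0 := Real.log_neg h.B_pos h.B_lt_one
  obtain ⟨t₀, ht₀, hΦ0, -⟩ := hΦ.exists_nonneg_monotone
  set R := min C₁ (t₀ / 2) with hRdef
  have hR : 0 < R := by positivity
  have hRC : R ≤ C₁ := min_le_left _ _
  have hRt : R < t₀ := (min_le_right _ _).trans_lt (by linarith)
  have hRle : R ^ (1 + Φ R) ≤ R := by
    simpa using Real.rpow_le_rpow_of_exponent_ge hR (hRC.trans hC₁'.le)
      (by linarith [hΦ0 R ⟨hR, hRt⟩] : (1 : ℝ) ≤ 1 + Φ R)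
  -- half of the least gain `(ψ - d) (-log B)` per level, so that the error `ε N` cannot offset it
  set ε := (ψ - d) * (-Real.log B) / 2 with hε
  have hε0 : 0 < ε := by
    have := mul_pos (sub_pos.2 hlt) (neg_pos.2 hlB)
    positivity
  have hrt : Tendsto (fun N => (1 - B) * moranLength a b v N) atTop (𝓝 0) := by
    simpa using (h.tendsto_length v).const_mul (1 - B)
  set m := (moranMeasure a b p).real (Metric.ball (moranPoint a b v) R) with hm
  have hm0 : 0 < m := h.real_ball_pos v hR
  have hbig : ∀ᶠ N : ℕ in atTop,
      Real.log C₂ + d * (Real.log R - Real.log (1 - B)) - Real.log m < ε * N :=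
    (tendsto_natCast_atTop_atTop.const_mul_atTop hε0).eventually_gt_atTop _
  obtain ⟨N, hN1, hN2, hN3⟩ := ((hv ε hε0).and ((hrt.eventually_lt_const
    (Real.rpow_pos_of_pos hR (1 + Φ R))).and hbig)).exists
  have hL := h.length_pos v N
  have hr : 0 < (1 - B) * moranLength a b v N := by positivity
  have key := hd R _ hr hN2 hR hRle hRC _ (h.moranPoint_mem_support v)
  have hmN := h.moranMass_pos v N
  have key2 : m / moranMass p v N ≤ C₂ * (R / ((1 - B) * moranLength a b v N)) ^ d :=
    (div_le_div_of_nonneg_left hm0.le (h.real_ball_pos v hr)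
      (h.real_ball_le_moranMass le_rfl)).trans key
  have key3 := Real.log_le_log (by positivity) key2
  rw [Real.log_div hm0.ne' hmN.ne', Real.log_mul hC₂.ne' (by positivity),
    Real.log_rpow (by positivity), Real.log_div hR.ne' hr.ne', Real.log_mul hB.ne' hL.ne'] at key3
  rw [← h.log_mass_sub_mul_log_length] at hN1
  have hLB := Real.log_le_log hL (h.length_le_pow v N)
  rw [Real.log_pow] at hLB
  have h5 := mul_le_mul_of_nonneg_left hLB (sub_pos.2 hlt).le
  have h6 : (ψ - d) * (N * Real.log B) = -(2 * (ε * N)) := by rw [hε]; ring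
  linarith

/-- If the weights along some address have averages with nonnegative lower limit, then the balls
around the point with that address rule out all exponents above `ψ`. -/
theorem lowerPhiDim_le {ψ : ℝ} {Φ : ℝ → ℝ} (hΦ : IsDimensionFunction Φ) {v : ℕ → Bool}
    (hv : ∀ ε > 0, ∀ᶠ N : ℕ in atTop, -(ε * N) ≤ ∑ i ∈ Finset.range N,
      (Real.log (branchProb p v i) - ψ * Real.log (branchRatio a b v i))) :
    lowerPhiDim Φ (moranMeasure a b p) ≤ (ψ : EReal) := by
  refine sSup_le ?_
  rintro _ ⟨d, ⟨C₁, C₂, hC₁, hC₁', hC₂, hd⟩, rfl⟩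
  refine EReal.coe_le_coe_iff.2 ?_
  by_contra! hlt
  have hlB : Real.log B < 0 := Real.log_neg h.B_pos h.B_lt_one
  obtain ⟨t₀, ht₀, hΦ0, -⟩ := hΦ.exists_nonneg_monotone
  set R := min C₁ (t₀ / 2) with hRdef
  have hR : 0 < R := by positivity
  have hRC : R ≤ C₁ := min_le_left _ _
  have hRt : R < t₀ := (min_le_right _ _).trans_lt (by linarith)
  have hRle : R ^ (1 + Φ R) ≤ R := by
    simpa using Real.rpow_le_rpow_of_exponent_ge hR (hRC.trans hC₁'.le)
      (by linarith [hΦ0 R ⟨hR, hRt⟩] : (1 : ℝ) ≤ 1 + Φ R)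
  -- half of the least gain `(d - ψ) (-log B)` per level, so that the error `ε N` cannot offset it
  set ε := (d - ψ) * (-Real.log B) / 2 with hε
  have hε0 : 0 < ε := by
    have := mul_pos (sub_pos.2 hlt) (neg_pos.2 hlB)
    positivity
  have hrt : Tendsto (fun N => 2 * moranLength a b v N) atTop (𝓝 0) := by
    simpa using (h.tendsto_length v).const_mul 2
  have hbig : ∀ᶠ N : ℕ in atTop,
      -(Real.log C₂ + d * (Real.log R - Real.log 2)) < ε * N :=
    (tendsto_natCast_atTop_atTop.const_mul_atTop hε0).eventually_gt_atTop _
  obtain ⟨N, hN1, hN2, hN3⟩ := ((hv ε hε0).and ((hrt.eventually_lt_const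
    (Real.rpow_pos_of_pos hR (1 + Φ R))).and hbig)).exists
  have hL := h.length_pos v N
  have hr : 0 < 2 * moranLength a b v N := by positivity
  have key := hd R _ hr hN2 hR hRle hRC _ (h.moranPoint_mem_support v)
  have hmN := h.moranMass_pos v N
  have key2 : C₂ * (R / (2 * moranLength a b v N)) ^ d ≤ 1 / moranMass p v N :=
    key.trans (div_le_div₀ zero_le_one measureReal_le_one hmN
      (h.moranMass_le_real_ball (by linarith)))
  have key3 := Real.log_le_log (by positivity) key2
  rw [Real.log_div one_ne_zero hmN.ne', Real.log_one, Real.log_mul hC₂.ne' (by positivity),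
    Real.log_rpow (by positivity), Real.log_div hR.ne' hr.ne', Real.log_mul two_ne_zero hL.ne']
    at key3
  rw [← h.log_mass_sub_mul_log_length] at hN1
  have hLB := Real.log_le_log hL (h.length_le_pow v N)
  rw [Real.log_pow] at hLB
  have h5 := mul_le_mul_of_nonneg_left hLB (sub_pos.2 hlt).le
  have h6 : (d - ψ) * (N * Real.log B) = -(2 * (ε * N)) := by rw [hε]; ring
  linarith

end IsMoranData

/-! ### The extremal branch weights -/

/-- `Y(θ) - θ Z(θ)`: the logarithm of the mass ratio minus `θ` times that of the length ratio,
for the branch that makes it smaller. -/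
noncomputable def branchMin (θ a b p : ℝ) : ℝ := branchY θ a b p - θ * branchZ θ a b p

/-- `Y'(θ) - θ Z'(θ)`: the logarithm of the mass ratio minus `θ` times that of the length ratio,
for the branch that makes it larger. -/
noncomputable def branchMax (θ a b p : ℝ) : ℝ := branchY' θ a b p - θ * branchZ' θ a b p

/-- The threshold of the definition of `Y(θ)` decides which of the two weights is smaller. -/
theorem le_threshold_iff {θ a b p : ℝ} (ha : 0 < a) (hb : 0 < b) (hp : 0 < p) (hp1 : p < 1) :
    p ≤ a ^ θ / (a ^ θ + b ^ θ) ↔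
      Real.log p - θ * Real.log a ≤ Real.log (1 - p) - θ * Real.log b := by
  have ha' := Real.rpow_pos_of_pos ha θ
  have hb' := Real.rpow_pos_of_pos hb θ
  have h1 : Real.log p - θ * Real.log a ≤ Real.log (1 - p) - θ * Real.log b ↔
      Real.log (p * b ^ θ) ≤ Real.log ((1 - p) * a ^ θ) := by
    rw [Real.log_mul hp.ne' hb'.ne', Real.log_mul (sub_pos.2 hp1).ne' ha'.ne', Real.log_rpow ha,
      Real.log_rpow hb]
    constructor <;> intro <;> linarith
  rw [h1, Real.log_le_log_iff (by positivity) (mul_pos (sub_pos.2 hp1) ha'),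
    le_div_iff₀ (by positivity)]
  constructor <;> intro <;> linarith

theorem branchMin_eq_min {θ a b p : ℝ} (ha : 0 < a) (hb : 0 < b) (hp : 0 < p) (hp1 : p < 1) :
    branchMin θ a b p =
      min (Real.log p - θ * Real.log a) (Real.log (1 - p) - θ * Real.log b) := by
  have h := le_threshold_iff (θ := θ) ha hb hp hp1
  unfold branchMin branchY branchZ
  split_ifs with hc
  · rw [min_eq_left (h.1 hc)]
  · rw [min_eq_right (le_of_not_ge fun h' => hc (h.2 h'))]

theorem branchMax_eq_max {θ a b p : ℝ} (ha : 0 < a) (hb : 0 < b) (hp : 0 < p) (hp1 : p < 1) :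
    branchMax θ a b p =
      max (Real.log p - θ * Real.log a) (Real.log (1 - p) - θ * Real.log b) := by
  have h := le_threshold_iff (θ := θ) ha hb hp hp1
  unfold branchMax branchY' branchZ'
  split_ifs with hc
  · rw [max_eq_left (le_of_not_ge fun h' => hc.not_ge (h.2 h'))]
  · rw [max_eq_right (h.1 (not_lt.1 hc))]

theorem abs_le_of_eq_log {p x : ℝ} (hp : 0 < p) (hp1 : p < 1)
    (hx : x = Real.log p ∨ x = Real.log (1 - p)) :
    |x| ≤ max (-Real.log p) (-Real.log (1 - p)) := by
  rcases hx with rfl | rfl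
  · rw [abs_of_neg (Real.log_neg hp hp1)]
    exact le_max_left _ _
  · rw [abs_of_neg (Real.log_neg (by linarith) (by linarith))]
    exact le_max_right _ _

theorem branchY_eq_or (θ a b p : ℝ) :
    branchY θ a b p = Real.log p ∨ branchY θ a b p = Real.log (1 - p) := by
  unfold branchY
  split_ifs <;> simp

theorem branchY'_eq_or (θ a b p : ℝ) :
    branchY' θ a b p = Real.log p ∨ branchY' θ a b p = Real.log (1 - p) := by
  unfold branchY'
  split_ifs <;> simp

theorem branchZ_mem_Icc {A B a b : ℝ} (hA : 0 < A) (ha : A ≤ a) (hb : A ≤ b) (hab : a + b ≤ B)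
    (θ p : ℝ) : branchZ θ a b p ∈ Icc (Real.log A) (Real.log B) := by
  unfold branchZ
  split_ifs
  · exact ⟨Real.log_le_log hA ha, Real.log_le_log (by linarith) (by linarith)⟩
  · exact ⟨Real.log_le_log hA hb, Real.log_le_log (by linarith) (by linarith)⟩

theorem branchZ'_mem_Icc {A B a b : ℝ} (hA : 0 < A) (ha : A ≤ a) (hb : A ≤ b) (hab : a + b ≤ B)
    (θ p : ℝ) : branchZ' θ a b p ∈ Icc (Real.log A) (Real.log B) := by
  unfold branchZ'
  split_ifs
  · exact ⟨Real.log_le_log hA ha, Real.log_le_log (by linarith) (by linarith)⟩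
  · exact ⟨Real.log_le_log hA hb, Real.log_le_log (by linarith) (by linarith)⟩

section Measurability

variable {α : Type*} [MeasurableSpace α] {f g k : α → ℝ}

theorem measurable_branchY (θ : ℝ) (hf : Measurable f) (hg : Measurable g) (hk : Measurable k) :
    Measurable fun x => branchY θ (f x) (g x) (k x) :=
  Measurable.ite (measurableSet_le hk (by fun_prop)) (by fun_prop) (by fun_prop)

theorem measurable_branchZ (θ : ℝ) (hf : Measurable f) (hg : Measurable g) (hk : Measurable k) :
    Measurable fun x => branchZ θ (f x) (g x) (k x) :=
  Measurable.ite (measurableSet_le hk (by fun_prop)) (by fun_prop) (by fun_prop)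

theorem measurable_branchY' (θ : ℝ) (hf : Measurable f) (hg : Measurable g) (hk : Measurable k) :
    Measurable fun x => branchY' θ (f x) (g x) (k x) :=
  Measurable.ite (measurableSet_lt (by fun_prop) hk) (by fun_prop) (by fun_prop)

theorem measurable_branchZ' (θ : ℝ) (hf : Measurable f) (hg : Measurable g) (hk : Measurable k) :
    Measurable fun x => branchZ' θ (f x) (g x) (k x) :=
  Measurable.ite (measurableSet_lt (by fun_prop) hk) (by fun_prop) (by fun_prop)

end Measurability

/-! ### Consequences of the random model -/

/-- Averages of i.i.d. variables with nonpositive mean have nonpositive upper limit. -/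
theorem ae_sum_range_le {Ω : Type*} [MeasurableSpace Ω] {P : Measure Ω}
    [IsProbabilityMeasure P] {X : ℕ → Ω → ℝ} (hind : iIndepFun X P)
    (hid : ∀ n, IdentDistrib (X n) (X 0) P P) (hint : Integrable (X 0) P)
    (hneg : ∫ ω, X 0 ω ∂P ≤ 0) :
    ∀ᵐ ω ∂P, ∀ ε > 0, ∀ᶠ N : ℕ in atTop, ∑ i ∈ Finset.range N, X i ω ≤ ε * N := by
  filter_upwards [strong_law_ae_real X hint (fun i j hij => hind.indepFun hij) hid] with ω hω ε hε
  filter_upwards [hω.eventually_lt_const (hneg.trans_lt hε), eventually_gt_atTop 0] with N hN hN0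
  have : (0 : ℝ) < N := by exact_mod_cast hN0
  exact ((div_lt_iff₀ this).1 hN).le

namespace IsRandomMoranModel

variable {Ω : Type*} [MeasurableSpace Ω] {P : Measure Ω} {A B : ℝ}
  {a b : ℕ → Ω → ℝ} {p : ℕ → Ω → I} (h : IsRandomMoranModel P A B a b p)

include h

theorem le_a (n : ℕ) (ω : Ω) : A ≤ a n ω := (h.le_min n ω).trans (min_le_left _ _)

theorem le_b (n : ℕ) (ω : Ω) : A ≤ b n ω := (h.le_min n ω).trans (min_le_right _ _)

theorem measurable_coe_p (n : ℕ) : Measurable fun ω => (p n ω : ℝ) :=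
  measurable_subtype_coe.comp (h.measurable_p n)

theorem ae_p_mem_Ioo (n : ℕ) : ∀ᵐ ω ∂P, (p n ω : ℝ) ∈ Ioo (0 : ℝ) 1 := by
  have h0 : ∀ᵐ ω ∂P, p 0 ω ∈ {x : I | (x : ℝ) ∈ Ioo (0 : ℝ) 1} := by
    obtain ⟨t, ht, h1, h2⟩ := h.moment_p
    have m1 := h.measurable_coe_p 0
    filter_upwards [ae_lt_top (by fun_prop) h1.ne, ae_lt_top (by fun_prop) h2.ne] with ω e1 e2
    constructor
    · by_contra! hle
      rw [ENNReal.ofReal_of_nonpos hle, ENNReal.zero_rpow_of_neg (by linarith)] at e1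
      exact lt_irrefl _ e1
    · by_contra! hle
      rw [ENNReal.ofReal_of_nonpos (by linarith), ENNReal.zero_rpow_of_neg (by linarith)] at e2
      exact lt_irrefl _ e2
  exact (h.identDistrib_p n).symm.ae_mem_snd (measurableSet_Ioo.preimage measurable_subtype_coe) h0

theorem ae_isMoranData :
    ∀ᵐ ω ∂P, IsMoranData A B (fun n => a n ω) (fun n => b n ω) (fun n => p n ω) := by
  filter_upwards [ae_all_iff.2 h.ae_p_mem_Ioo] with ω hω
  exact ⟨h.A_pos, h.B_lt_one, fun n => h.le_a n ω, fun n => h.le_b n ω, fun n => h.add_le n ω,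
    fun n => (hω n).1, fun n => (hω n).2⟩

/-- A variable of at most logarithmic size in `p` and `1 - p` has exponential moments, by the
moment condition on `p`. -/
theorem zero_mem_interior_integrableExpSet {X : Ω → ℝ} (hX : Measurable X) {c : ℝ}
    (hXc : ∀ᵐ ω ∂P, |X ω| ≤
      c + max (-Real.log (p 0 ω : ℝ)) (-Real.log (1 - (p 0 ω : ℝ)))) :
    0 ∈ interior (integrableExpSet X P) := by
  obtain ⟨t, ht, h1, h2⟩ := h.moment_p
  have m1 := h.measurable_coe_p 0
  have i1 : Integrable (fun ω => (p 0 ω : ℝ) ^ (-t)) P := by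
    refine ⟨Measurable.aestronglyMeasurable (by measurability), ?_⟩
    rw [hasFiniteIntegral_iff_ofReal
      (Eventually.of_forall fun ω => Real.rpow_nonneg (p 0 ω).2.1 _)]
    refine lt_of_eq_of_lt (lintegral_congr_ae ?_) h1
    filter_upwards [h.ae_p_mem_Ioo 0] with ω hω
    exact (ENNReal.ofReal_rpow_of_pos hω.1).symm
  have i2 : Integrable (fun ω => (1 - (p 0 ω : ℝ)) ^ (-t)) P := by
    refine ⟨Measurable.aestronglyMeasurable (by measurability), ?_⟩
    rw [hasFiniteIntegral_iff_ofReal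
      (Eventually.of_forall fun ω => Real.rpow_nonneg (by linarith [(p 0 ω).2.2]) _)]
    refine lt_of_eq_of_lt (lintegral_congr_ae ?_) h2
    filter_upwards [h.ae_p_mem_Ioo 0] with ω hω
    exact (ENNReal.ofReal_rpow_of_pos (sub_pos.2 hω.2)).symm
  have hmem : ∀ s : ℝ, |s| ≤ t → s ∈ integrableExpSet X P := by
    intro s hs
    refine ((i1.add i2).const_mul (Real.exp (t * c))).mono' (by fun_prop) ?_
    filter_upwards [hXc, h.ae_p_mem_Ioo 0] with ω hω hp
    have hq : 0 < 1 - (p 0 ω : ℝ) := sub_pos.2 hp.2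
    rw [Real.norm_of_nonneg (Real.exp_pos _).le, Pi.add_apply, Real.rpow_def_of_pos hp.1,
      Real.rpow_def_of_pos hq]
    have hsX : s * X ω ≤ t * |X ω| := by
      calc s * X ω ≤ |s * X ω| := le_abs_self _
        _ = |s| * |X ω| := abs_mul _ _
        _ ≤ _ := mul_le_mul_of_nonneg_right hs (abs_nonneg _)
    have hle := hsX.trans (mul_le_mul_of_nonneg_left hω ht.le)
    rcases max_choice (-Real.log (p 0 ω : ℝ)) (-Real.log (1 - (p 0 ω : ℝ))) with e | e <;>
      rw [e] at hle
    · calc Real.exp (s * X ω) ≤ Real.exp (t * c + Real.log (p 0 ω) * -t) :=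
            Real.exp_le_exp.2 (by linarith)
        _ = Real.exp (t * c) * Real.exp (Real.log (p 0 ω) * -t) := Real.exp_add _ _
        _ ≤ _ := by
          gcongr
          linarith [Real.exp_pos (Real.log (1 - (p 0 ω : ℝ)) * -t)]
    · calc Real.exp (s * X ω) ≤ Real.exp (t * c + Real.log (1 - (p 0 ω : ℝ)) * -t) :=
            Real.exp_le_exp.2 (by linarith)
        _ = Real.exp (t * c) * Real.exp (Real.log (1 - (p 0 ω : ℝ)) * -t) := Real.exp_add _ _
        _ ≤ _ := by
          gcongr
          linarith [Real.exp_pos (Real.log (p 0 ω : ℝ) * -t)]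
  rw [mem_interior_iff_mem_nhds]
  filter_upwards [Ioo_mem_nhds (neg_lt_zero.2 ht) ht] with s hs
  exact hmem s (abs_le.2 ⟨hs.1.le, hs.2.le⟩)

variable [IsProbabilityMeasure P]

theorem iIndepFun_identDistrib {f : ℝ → ℝ → ℝ → ℝ}
    (hf : Measurable fun x : (ℝ × ℝ) × I => f x.1.1 x.1.2 x.2) :
    iIndepFun (fun n ω => f (a n ω) (b n ω) (p n ω)) P ∧
      ∀ n, IdentDistrib (fun ω => f (a n ω) (b n ω) (p n ω))
        (fun ω => f (a 0 ω) (b 0 ω) (p 0 ω)) P P := by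
  have hind : iIndepFun (fun n ω => ((a n ω, b n ω), p n ω)) P :=
    iIndepFun_prodMk_of_indepFun (fun n => (h.measurable_a n).prodMk (h.measurable_b n))
      h.measurable_p h.iIndep_ratios h.iIndep_p h.indep_ratios_p
  have hn : ∀ n, IndepFun (fun ω => (a n ω, b n ω)) (p n) P := fun n =>
    h.indep_ratios_p.comp (measurable_pi_apply n) (measurable_pi_apply n)
  exact ⟨hind.comp (fun _ x => f x.1.1 x.1.2 x.2) fun _ => hf, fun n =>
    ((h.identDistrib_ratios n).prodMk (h.identDistrib_p n) (hn n) (hn 0)).comp hf⟩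

theorem integrable_of_mem_Icc {X : Ω → ℝ} (hX : Measurable X)
    (hXc : ∀ ω, X ω ∈ Icc (Real.log A) (Real.log B)) :
    Integrable X P ∧ ∫ ω, X ω ∂P < 0 := by
  have hi : Integrable X P := Integrable.of_mem_Icc _ _ hX.aemeasurable (Eventually.of_forall hXc)
  refine ⟨hi, ?_⟩
  calc ∫ ω, X ω ∂P ≤ ∫ _, Real.log B ∂P :=
        integral_mono hi (integrable_const _) fun ω => (hXc ω).2
    _ = Real.log B := by simp
    _ < 0 := Real.log_neg (h.A_pos.trans h.A_lt_B) h.B_lt_one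

/-- The weight variables formed from `Y` and `Z` (or `Y'` and `Z'`): integrability of all terms,
exponential moments, and the sign of the mean of `Y - ψ Z` in terms of `G = 𝔼 Y / 𝔼 Z`. -/
theorem weight_properties {Y Z : Ω → ℝ} {ψ : ℝ} (hψ : 0 ≤ ψ) (hY : Measurable Y)
    (hZ : Measurable Z)
    (hYp : ∀ ω, Y ω = Real.log (p 0 ω : ℝ) ∨ Y ω = Real.log (1 - (p 0 ω : ℝ)))
    (hZm : ∀ ω, Z ω ∈ Icc (Real.log A) (Real.log B)) :
    0 ∈ interior (integrableExpSet (fun ω => Y ω - ψ * Z ω) P) ∧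
      0 ∈ interior (integrableExpSet (fun ω => -(Y ω - ψ * Z ω)) P) ∧
      ((∫ ω, Y ω ∂P) / (∫ ω, Z ω ∂P) < ψ ↔ 0 < ∫ ω, Y ω - ψ * Z ω ∂P) ∧
      (ψ < (∫ ω, Y ω ∂P) / (∫ ω, Z ω ∂P) ↔ ∫ ω, Y ω - ψ * Z ω ∂P < 0) := by
  obtain ⟨iZ, nZ⟩ := h.integrable_of_mem_Icc hZ hZm
  have bY : ∀ᵐ ω ∂P, |Y ω| ≤ max (-Real.log (p 0 ω : ℝ)) (-Real.log (1 - (p 0 ω : ℝ))) := by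
    filter_upwards [h.ae_p_mem_Ioo 0] with ω hp
    exact abs_le_of_eq_log hp.1 hp.2 (hYp ω)
  have iY : Integrable Y P := integrable_of_mem_interior_integrableExpSet
    (h.zero_mem_interior_integrableExpSet (c := 0) hY (by simpa using bY))
  have bW : ∀ᵐ ω ∂P, |Y ω - ψ * Z ω| ≤ ψ * -Real.log A +
      max (-Real.log (p 0 ω : ℝ)) (-Real.log (1 - (p 0 ω : ℝ))) := by
    filter_upwards [bY] with ω hω
    have hB := Real.log_neg (h.A_pos.trans h.A_lt_B) h.B_lt_one
    have hZω : |Z ω| ≤ -Real.log A := by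
      rw [abs_of_neg ((hZm ω).2.trans_lt hB)]
      exact neg_le_neg (hZm ω).1
    calc |Y ω - ψ * Z ω| ≤ |Y ω| + |ψ * Z ω| := abs_sub _ _
      _ = |Y ω| + ψ * |Z ω| := by rw [abs_mul, abs_of_nonneg hψ]
      _ ≤ _ := by linarith [mul_le_mul_of_nonneg_left hZω hψ]
  have hint : ∫ ω, Y ω - ψ * Z ω ∂P = ∫ ω, Y ω ∂P - ψ * ∫ ω, Z ω ∂P := by
    rw [integral_sub iY (iZ.const_mul ψ), integral_const_mul]
  refine ⟨h.zero_mem_interior_integrableExpSet (by fun_prop) bW,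
    h.zero_mem_interior_integrableExpSet (by fun_prop) (by simpa only [abs_neg] using bW), ?_, ?_⟩
  · rw [hint, div_lt_iff_of_neg nZ, sub_pos]
  · rw [hint, lt_div_iff_of_neg nZ, sub_neg]

end IsRandomMoranModel

/-- An almost sure property holds on a measurable set of probability one. -/
theorem exists_measurableSet_of_ae {Ω : Type*} [MeasurableSpace Ω] {P : Measure Ω}
    [IsProbabilityMeasure P] {q : Ω → Prop} (hq : ∀ᵐ ω ∂P, q ω) :
    ∃ Γ : Set Ω, MeasurableSet Γ ∧ P Γ = 1 ∧ ∀ ω ∈ Γ, q ω := by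
  obtain ⟨s, hs, hsm, hs0⟩ := exists_measurable_superset_of_null (ae_iff.1 hq)
  exact ⟨sᶜ, hsm.compl, (prob_compl_eq_one_iff hsm).2 hs0, fun ω hω =>
    not_not.1 fun hn => hω (hs hn)⟩

/-! ### The dimensions of random Moran measures -/

theorem mainTheorem1 {Ω : Type*} [MeasurableSpace Ω] (P : Measure Ω) [IsProbabilityMeasure P]
    (A B : ℝ) (a b : ℕ → Ω → ℝ) (p : ℕ → Ω → unitInterval)
    (hmodel : IsRandomMoranModel P A B a b p) (ψ : ℝ) (hψ : 0 ≤ ψ) :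
    (moranG P a b p ψ < ψ →
      ∃ Γ : Set Ω, MeasurableSet Γ ∧ P Γ = 1 ∧ ∀ ω ∈ Γ, ∀ Φ : ℝ → ℝ, IsLargeDimensionFunction Φ →
        upperPhiDim Φ (randomMoranMeasure a b p ω) ≤ (ψ : EReal)) ∧
    (ψ ≤ moranG P a b p ψ →
      ∃ Γ : Set Ω, MeasurableSet Γ ∧ P Γ = 1 ∧ ∀ ω ∈ Γ, ∀ Φ : ℝ → ℝ, IsLargeDimensionFunction Φ →
        (ψ : EReal) ≤ upperPhiDim Φ (randomMoranMeasure a b p ω)) ∧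
    (ψ < moranG' P a b p ψ →
      ∃ Γ : Set Ω, MeasurableSet Γ ∧ P Γ = 1 ∧ ∀ ω ∈ Γ, ∀ Φ : ℝ → ℝ, IsLargeDimensionFunction Φ →
        (ψ : EReal) ≤ lowerPhiDim Φ (randomMoranMeasure a b p ω)) ∧
    (moranG' P a b p ψ ≤ ψ →
      ∃ Γ : Set Ω, MeasurableSet Γ ∧ P Γ = 1 ∧ ∀ ω ∈ Γ, ∀ Φ : ℝ → ℝ, IsLargeDimensionFunction Φ →
        lowerPhiDim Φ (randomMoranMeasure a b p ω) ≤ (ψ : EReal)) := by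
  have hx1 : Measurable fun x : (ℝ × ℝ) × I => x.1.1 := by fun_prop
  have hx2 : Measurable fun x : (ℝ × ℝ) × I => x.1.2 := by fun_prop
  have hx3 : Measurable fun x : (ℝ × ℝ) × I => (x.2 : ℝ) := by fun_prop
  have mMin : Measurable fun x : (ℝ × ℝ) × I => branchMin ψ x.1.1 x.1.2 x.2 :=
    (measurable_branchY ψ hx1 hx2 hx3).sub ((measurable_branchZ ψ hx1 hx2 hx3).const_mul ψ)
  have mMax : Measurable fun x : (ℝ × ℝ) × I => branchMax ψ x.1.1 x.1.2 x.2 :=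
    (measurable_branchY' ψ hx1 hx2 hx3).sub ((measurable_branchZ' ψ hx1 hx2 hx3).const_mul ψ)
  have ma := hmodel.measurable_a
  have mb := hmodel.measurable_b
  have mp := hmodel.measurable_coe_p
  have mn : ∀ n, Measurable fun ω => ((a n ω, b n ω), p n ω) := fun n =>
    ((ma n).prodMk (mb n)).prodMk (hmodel.measurable_p n)
  obtain ⟨hInd, hId⟩ := hmodel.iIndepFun_identDistrib mMin
  obtain ⟨hInd', hId'⟩ := hmodel.iIndepFun_identDistrib mMax
  obtain ⟨hI, hIneg, hlt, -⟩ := hmodel.weight_properties hψ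
    (measurable_branchY ψ (ma 0) (mb 0) (mp 0)) (measurable_branchZ ψ (ma 0) (mb 0) (mp 0))
    (fun ω => branchY_eq_or _ _ _ _) (fun ω => branchZ_mem_Icc hmodel.A_pos (hmodel.le_a 0 ω)
      (hmodel.le_b 0 ω) (hmodel.add_le 0 ω) _ _)
  obtain ⟨hI', hIneg', -, hgt'⟩ := hmodel.weight_properties hψ
    (measurable_branchY' ψ (ma 0) (mb 0) (mp 0)) (measurable_branchZ' ψ (ma 0) (mb 0) (mp 0))
    (fun ω => branchY'_eq_or _ _ _ _) (fun ω => branchZ'_mem_Icc hmodel.A_pos (hmodel.le_a 0 ω)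
      (hmodel.le_b 0 ω) (hmodel.add_le 0 ω) _ _)
  refine ⟨fun hG => ?_, fun hG => ?_, fun hG => ?_, fun hG => ?_⟩ <;>
    apply exists_measurableSet_of_ae
  · have hpos := hlt.1 hG
    obtain ⟨K, hK, hae⟩ := ae_sum_Ico_nonpos
      (X := fun n ω => -branchMin ψ (a n ω) (b n ω) (p n ω))
      (fun n => (mMin.comp (mn n)).neg) (hInd.comp (fun _ x => -x) fun _ => measurable_neg)
      (fun n => (hId n).comp measurable_neg) hIneg
      (by rw [integral_neg]; exact neg_lt_zero.2 hpos)
    filter_upwards [hae, hmodel.ae_isMoranData] with ω ⟨N₀, hN₀⟩ hω Φ hΦ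
    refine hω.upperPhiDim_le hψ hΦ (W := fun n => branchMin ψ (a n ω) (b n ω) (p n ω))
      (fun v i => ?_) hK (N₀ := N₀) fun N M hN hNM hlog => ?_
    · rw [branchMin_eq_min (hω.a_pos i) (hω.b_pos i) (hω.p_pos i) (hω.p_lt_one i)]
      unfold branchProb branchRatio
      split_ifs
      exacts [min_le_right _ _, min_le_left _ _]
    · have := hN₀ N M hN hNM hlog
      rw [Finset.sum_neg_distrib] at this
      exact neg_nonpos.1 this
  · have hle : ∫ ω, branchMin ψ (a 0 ω) (b 0 ω) (p 0 ω) ∂P ≤ 0 :=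
      not_lt.1 fun hc => hG.not_gt (hlt.2 hc)
    filter_upwards [ae_sum_range_le hInd hId (integrable_of_mem_interior_integrableExpSet hI) hle,
      hmodel.ae_isMoranData] with ω hsum hω Φ hΦ
    -- the address that takes at each level the branch of `Y` and `Z`
    refine hω.le_upperPhiDim hΦ.toIsDimensionFunction (v := fun i =>
      !decide ((p i ω : ℝ) ≤ a i ω ^ ψ / (a i ω ^ ψ + b i ω ^ ψ))) fun ε hε => ?_
    filter_upwards [hsum ε hε] with N hN
    refine (Finset.sum_congr rfl fun i _ => ?_).trans_le hN
    unfold branchProb branchRatio branchMin branchY branchZ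
    by_cases hc : (p i ω : ℝ) ≤ a i ω ^ ψ / (a i ω ^ ψ + b i ω ^ ψ) <;> simp [hc]
  · have hneg := hgt'.1 hG
    obtain ⟨K, hK, hae⟩ := ae_sum_Ico_nonpos
      (X := fun n ω => branchMax ψ (a n ω) (b n ω) (p n ω))
      (fun n => mMax.comp (mn n)) hInd' hId' hI' hneg
    filter_upwards [hae, hmodel.ae_isMoranData] with ω ⟨N₀, hN₀⟩ hω Φ hΦ
    refine hω.le_lowerPhiDim hψ hΦ (W := fun n => branchMax ψ (a n ω) (b n ω) (p n ω))
      (fun v i => ?_) hK (N₀ := N₀) hN₀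
    rw [branchMax_eq_max (hω.a_pos i) (hω.b_pos i) (hω.p_pos i) (hω.p_lt_one i)]
    unfold branchProb branchRatio
    split_ifs
    exacts [le_max_right _ _, le_max_left _ _]
  · have hge : 0 ≤ ∫ ω, branchMax ψ (a 0 ω) (b 0 ω) (p 0 ω) ∂P :=
      not_lt.1 fun hc => hG.not_gt (hgt'.2 hc)
    filter_upwards [ae_sum_range_le (X := fun n ω => -branchMax ψ (a n ω) (b n ω) (p n ω))
        (hInd'.comp (fun _ x => -x) fun _ => measurable_neg)
        (fun n => (hId' n).comp measurable_neg)
        (integrable_of_mem_interior_integrableExpSet hIneg')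
        (by rw [integral_neg]; exact neg_nonpos.2 hge),
      hmodel.ae_isMoranData] with ω hsum hω Φ hΦ
    -- the address that takes at each level the branch of `Y'` and `Z'`
    refine hω.lowerPhiDim_le hΦ.toIsDimensionFunction (v := fun i =>
      !decide (a i ω ^ ψ / (a i ω ^ ψ + b i ω ^ ψ) < (p i ω : ℝ))) fun ε hε => ?_
    filter_upwards [hsum ε hε] with N hN
    rw [Finset.sum_neg_distrib, neg_le] at hN
    refine hN.trans_eq (Finset.sum_congr rfl fun i _ => ?_)
    unfold branchProb branchRatio branchMax branchY' branchZ'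
    by_cases hc : a i ω ^ ψ / (a i ω ^ ψ + b i ω ^ ψ) < (p i ω : ℝ) <;> simp [hc]
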